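/- **Setting.** Let $T>0$, $L\in\mathbb N\cup\{0\}$. Let $G[0,T]$ be the set of regulated functions on $[0,T]$ (finite one-sided limits exist at every point), $G_R[0,T]$ the set of right-continuous regulated functions, $G_R([0,T];\mathbb R^L)$ its vector-valued analogue, and $BV_R[0,T]=BV[0,T]\cap G_R[0,T]$. Put $|w|_{[0,t]}=\sup_{\tau\in[0,t]}|w(\tau)|$ and $\|\mathbf u\|_{[0,t]}=\sup_{\tau\in[0,t]}\|\mathbf u(\tau)\|$ with the Euclidean norm on $\mathbb R^L$. For $r>0$ and $q\in G_R[0,T]$ let $\mathfrak p_r[q]=\xi_r\in BV_R[0,T]$ be the solution (the play) of $$|q(t)-\xi_r(t)|\le r\quad\forall t\in[0,T],$$ $$\int_0^T\big(q(t)-\xi_r(t)-z(t)\big)\,d\xi_r(t)\ge 0\quad\forall z\in G[0,T],\ |z|_{[0,T]}\le r,$$ $$\xi_r(0)=\max\{q(0)-r,\min\{0,q(0)+r\}\},$$ where the integral is the Kurzweil-Stieltjes integral. For a density $\psi:\mathbb R^L\times(0,\infty)\times\mathbb R\to\mathbb R$ and $\mathbf u\in G_R([0,T];\mathbb R^L)$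 define the Preisach operator $$\mathcal P(\mathbf u)[q](t)=\int_0^\infty\int_0^{\xi_r(t)}\psi(\mathbf u(t),r,v)\,dv\,dr .$$ **Theorem.** Let $\psi$ be (Lebesgue) measurable, and let $\mu\in L^1(0,\infty)$ and $K\in L^1((0,\infty)\times\mathbb R)$ be such that * for every $\mathbf u\in\mathbb R^L$, $0\le\psi(\mathbf u,r,v)\le\mu(r)$ for a.e. $(r,v)\in(0,\infty)\times\mathbb R$; * for every $\mathbf u\in\mathbb R^L$, for a.e. $(r,v)$, $\psi(\cdot,r,v)$ is differentiable at $\mathbf u$ and $\|\nabla_{\mathbf u}\psi(\mathbf u,r,v)\|\le K(r,v)$; * for a.e. $(r,v)$, the function $\mathbf u\mapsto\psi(\mathbf u,r,v)$ is locally Lipschitz. Put $M=\int_0^\infty\mu(r)\,dr$ and $M_1=\int_0^\infty\int_{-\infty}^\infty K(r,v)\,dv\,dr$. Let $\mathbf u,\hat{\mathbf u}\in G_R([0,T];\mathbb R^L)$ and $w,\hat w\in G_R[0,T]$. Then there exist solutions $q,\hat q\in G_R[0,T]$ of $$q(t)+\mathcal P(\mathbf u)[q](t)=w(t),\qquad \hat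 q(t)+\mathcal P(\hat{\mathbf u})[\hat q](t)=\hat w(t),\qquad t\in[0,T]$$ (in particular the plays and integrals that occur here exist), and any such solutions satisfy $$|q(t)-\hat q(t)|\le e^{M}\big(|w-\hat w|_{[0,t]}+M_1\,\|\mathbf u-\hat{\mathbf u}\|_{[0,t]}\big)\qquad\text{for every }t\in[0,T].$$ -/

import Mathlib

namespace Preisach

open MeasureTheory Set Filter Topology

/-- Regulated functions on `[0,T]`: finite one-sided limits exist at every point of `[0,T]`. Functions
on `[0,T]` are represented by functions on `ℝ`; only their values on `[0,T]` play a role. -/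
structure Regulated {F : Type*} [TopologicalSpace F] (T : ℝ) (f : ℝ → F) : Prop where
  right_lim : ∀ t ∈ Ico 0 T, ∃ l, Tendsto f (𝓝[>] t) (𝓝 l)
  left_lim : ∀ t ∈ Ioc 0 T, ∃ l, Tendsto f (𝓝[<] t) (𝓝 l)

/-- The space `G_R[0,T]` of right-continuous regulated functions on `[0,T]`. -/
structure RightRegulated {F : Type*} [TopologicalSpace F] (T : ℝ) (f : ℝ → F) : Prop
    extends Regulated T f where
  right_cont : ∀ t ∈ Ico 0 T, Tendsto f (𝓝[>] t) (𝓝 (f t))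

/-- The seminorm `sup_{τ ∈ [s,t]} ‖f τ‖`. -/
noncomputable def supNorm {F : Type*} [Norm F] (s t : ℝ) (f : ℝ → F) : ℝ :=
  sSup ((fun τ => ‖f τ‖) '' Icc s t)

/-- `s 0 < s 1 < ⋯ < s n` is a division of `[a,b]`, with tags `τ i ∈ [s i, s (i+1)]`, that is
fine with respect to the gauge `δ`. -/
structure IsFinePartition (δ : ℝ → ℝ) (a b : ℝ) (n : ℕ) (s τ : ℕ → ℝ) : Prop where
  left_end : s 0 = a
  right_end : s n = b
  lt : ∀ i < n, s i < s (i + 1)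
  tag_mem : ∀ i < n, τ i ∈ Icc (s i) (s (i + 1))
  fine : ∀ i < n, Icc (s i) (s (i + 1)) ⊆ Ioo (τ i - δ (τ i)) (τ i + δ (τ i))

/-- The Kurzweil-Stieltjes integral `∫_a^b f dg` exists and equals `I`. -/
def HasKSIntegral (f g : ℝ → ℝ) (a b I : ℝ) : Prop :=
  ∀ ε > 0, ∃ δ : ℝ → ℝ, (∀ t ∈ Icc a b, 0 < δ t) ∧
    ∀ (n : ℕ) (s τ : ℕ → ℝ), IsFinePartition δ a b n s τ →
      |(∑ i ∈ Finset.range n, f (τ i) * (g (s (i + 1)) - g (s i))) - I| < ε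

/-- `ξ` is a solution in `BV_R[0,T]` of the variational inequality that defines the play with
threshold `r` and input `q`. -/
structure IsPlay (T r : ℝ) (q ξ : ℝ → ℝ) : Prop where
  bv : BoundedVariationOn ξ (Icc 0 T)
  reg : RightRegulated T ξ
  dist_le : ∀ t ∈ Icc 0 T, |q t - ξ t| ≤ r
  var_ineq : ∀ z : ℝ → ℝ, Regulated T z → (∀ t ∈ Icc 0 T, |z t| ≤ r) →
    ∃ I : ℝ, HasKSIntegral (fun t => q t - ξ t - z t) ξ 0 T I ∧ 0 ≤ I
  init : ξ 0 = max (q 0 - r) (min 0 (q 0 + r))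

/-- The play operator `𝔭_r[q]`: the solution of the variational inequality. -/
noncomputable def play (T r : ℝ) (q : ℝ → ℝ) : ℝ → ℝ :=
  Classical.epsilon (IsPlay T r q)

variable {L : ℕ}

/-- The parameter-dependent Preisach operator
`P(u)[q](t) = ∫_0^∞ ∫_0^{ξ_r(t)} ψ(u(t),r,v) dv dr`, where `ξ_r = 𝔭_r[q]`. -/
noncomputable def preisach (T : ℝ) (ψ : EuclideanSpace ℝ (Fin L) → ℝ → ℝ → ℝ)
    (u : ℝ → EuclideanSpace ℝ (Fin L)) (q : ℝ → ℝ) (t : ℝ) : ℝ :=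
  ∫ r in Ioi 0, ∫ v in 0..play T r q t, ψ (u t) r v

/-- The hypothesis on the density: for every `u`, `0 ≤ ψ(u,r,v) ≤ μ(r)` and `‖∇_u ψ(u,r,v)‖ ≤ K(r,v)`
for almost every `(r,v) ∈ (0,∞) × ℝ`, with `μ` and `K` integrable. -/
structure DensityHyp (ψ : EuclideanSpace ℝ (Fin L) → ℝ → ℝ → ℝ) (μ : ℝ → ℝ) (K : ℝ → ℝ → ℝ) :
    Prop where
  /-- Lebesgue measurability on `ℝ^L × (0,∞) × ℝ`. -/
  meas : AEMeasurable (fun p : EuclideanSpace ℝ (Fin L) × ℝ × ℝ => ψ p.1 p.2.1 p.2.2)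
    (volume.restrict (univ ×ˢ (Ioi 0 ×ˢ univ)))
  μ_int : IntegrableOn μ (Ioi 0)
  bound : ∀ u, ∀ᵐ p : ℝ × ℝ ∂volume.restrict (Ioi 0 ×ˢ univ),
    0 ≤ ψ u p.1 p.2 ∧ ψ u p.1 p.2 ≤ μ p.1
  K_int : IntegrableOn (fun p : ℝ × ℝ => K p.1 p.2) (Ioi 0 ×ˢ univ)
  /-- The regularity in `u` without which an almost everywhere gradient carries no information on
  increments of `ψ` (consider jumps or Cantor functions of `u - v`). It holds automatically
  if, for almost every `(r,v)`, the gradient exists and is bounded by `K(r,v)` at every `u`. -/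
  loc_lip : ∀ᵐ p : ℝ × ℝ ∂volume.restrict (Ioi 0 ×ˢ univ),
    LocallyLipschitz (fun u => ψ u p.1 p.2)
  grad_bound : ∀ u, ∀ᵐ p : ℝ × ℝ ∂volume.restrict (Ioi 0 ×ˢ univ),
    DifferentiableAt ℝ (fun u' => ψ u' p.1 p.2) u ∧
      ‖gradient (fun u' => ψ u' p.1 p.2) u‖ ≤ K p.1 p.2

/-- `q ∈ G_R[0,T]` is a solution of `q(t) + P(u)[q](t) = w(t)`, `t ∈ [0,T]`; this includes that the
plays and the integrals in `P(u)[q]` exist. -/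
structure IsSolution (T : ℝ) (ψ : EuclideanSpace ℝ (Fin L) → ℝ → ℝ → ℝ)
    (u : ℝ → EuclideanSpace ℝ (Fin L)) (w q : ℝ → ℝ) : Prop where
  reg : RightRegulated T q
  play_exists : ∀ r > 0, ∃ ξ, IsPlay T r q ξ
  inner_int : ∀ t ∈ Icc 0 T, ∀ᵐ r ∂volume.restrict (Ioi 0),
    IntervalIntegrable (ψ (u t) r) volume 0 (play T r q t)
  outer_int : ∀ t ∈ Icc 0 T,
    IntegrableOn (fun r => ∫ v in 0..play T r q t, ψ (u t) r v) (Ioi 0)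
  eqn : ∀ t ∈ Icc 0 T, q t + preisach T ψ u q t = w t

end Preisach

namespace Preisach

open MeasureTheory Set Filter Topology

/-! ### Chains in a real interval -/

/-! The estimate is proved first for sequences of inputs. There the state of all plays is a curve
over the thresholds, `memory x k`, and each new input `x k` projects its value at `r` onto `[x k -
r, x k + r]`. Let two sequences satisfy the difference of the two equations up to an error `E > 0`,
and let `d` be the difference of their memory curves. The invariant is `|d(r)| ≤ φ(r)` with `φ(r) =
E exp(∫_r^∞ μ)`, the solution of `φ(r) = E + ∫_r^∞ μ φ`. Suppose that an update pushes `d(r)` above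
`φ(r)`. Then `d` has increased at `r`, which forces `d(s) ≥ d(r)` for all `s ≤ r`
(`memory_sub_memory_le`); with the sequences exchanged, the same fact forbids `d(s) < -φ(s)` for `s
> r`. Since `ψ ≥ 0`, thresholds up to `r` contribute a nonnegative amount to the difference of the
Preisach terms, and those above `r` contribute at least `-∫_r^∞ μ φ`. The play with threshold `0` is
the input itself, so the difference of the inputs is `d(0) ≥ d(r) > φ(r)`, and the equations give `E
> φ(r) - ∫_r^∞ μ φ = E`, a contradiction. At `r = 0` the invariant has the constant `e^M`
(`DensityHyp.abs_sub_le_of_discrete`).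

Right-continuous regulated functions are uniform limits of step functions and the play is
nonexpansive in the sup norm, so the estimate passes to continuous time (`DensityHyp.abs_sub_le`);
changing the parameter costs `M₁ ‖u - u'‖` on the right-hand side. For existence, the discrete
equation is solved one step at a time by the intermediate value theorem, and stability makes the
resulting step solutions uniformly Cauchy.

All this uses `explicitPlay`, given by its sublevels. It is the play of the statement because it
solves the variational inequality (`isPlay_explicitPlay`), whose solution is unique
(`IsPlay.eq_of_isPlay`). Both facts rest on bounding Kurzweil-Stieltjes integrals from below by
minor functions, which need only be checked near each point. -/

theorem reflTransGen_of_eventually {R : ℝ → ℝ → Prop} {a b : ℝ} (hab : a ≤ b)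
    (hl : ∀ c ∈ Ioc a b, ∀ᶠ x in 𝓝[<] c, a ≤ x → R x c)
    (hr : ∀ c ∈ Ico a b, ∀ᶠ y in 𝓝[>] c, y ≤ b → R c y) :
    Relation.ReflTransGen (fun x y => a ≤ x ∧ x < y ∧ y ≤ b ∧ R x y) a b := by
  set Q := fun x y => a ≤ x ∧ x < y ∧ y ≤ b ∧ R x y
  set S := {c | c ∈ Icc a b ∧ Relation.ReflTransGen Q a c} with hS
  have haS : a ∈ S := ⟨left_mem_Icc.2 hab, .refl⟩
  have hbdd : BddAbove S := ⟨b, fun c hc => hc.1.2⟩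
  set c := sSup S with hc
  have hac : a ≤ c := le_csSup hbdd haS
  have hcb : c ≤ b := csSup_le ⟨a, haS⟩ fun x hx => hx.1.2
  -- The supremum is itself reached, by the hypothesis on the left of `c`; if `c < b`, the
  -- hypothesis on the right would carry a chain beyond it.
  have hcS : c ∈ S := by
    rcases hac.eq_or_lt with h | h
    · rw [← h]; exact haS
    obtain ⟨l, hlc, hl'⟩ := (mem_nhdsLT_iff_exists_Ioo_subset).1 (hl c ⟨h, hcb⟩)
    obtain ⟨x, hxS, hx⟩ := exists_lt_of_lt_csSup ⟨a, haS⟩ (show l < sSup S from hlc)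
    rcases (le_csSup hbdd hxS).eq_or_lt with hxc | hxc
    · rw [hc, ← hxc]; exact hxS
    · exact ⟨⟨hac, hcb⟩, hxS.2.tail ⟨hxS.1.1, hxc, hcb, hl' ⟨hx, hxc⟩ hxS.1.1⟩⟩
  rcases hcb.eq_or_lt with h | h
  · rw [← h]; exact hcS.2
  obtain ⟨u, hcu, hu⟩ := (mem_nhdsGT_iff_exists_Ioo_subset).1 (hr c ⟨hac, h⟩)
  obtain ⟨y, hy⟩ := exists_between (lt_min (show c < u from hcu) h)
  have hyb : y ≤ b := (hy.2.trans_le (min_le_right _ _)).le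
  have : y ∈ S := ⟨⟨hac.trans hy.1.le, hyb⟩,
    hcS.2.tail ⟨hac, hy.1, hyb, hu ⟨hy.1, hy.2.trans_le (min_le_left _ _)⟩ hyb⟩⟩
  exact absurd (le_csSup hbdd this) (not_le.2 hy.1)

theorem exists_sequence_of_reflTransGen {α : Type*} {R : α → α → Prop} {a b : α}
    (h : Relation.ReflTransGen R a b) :
    ∃ (n : ℕ) (t : ℕ → α), t 0 = a ∧ t n = b ∧ ∀ i < n, R (t i) (t (i + 1)) := by
  induction h with
  | refl => exact ⟨0, fun _ => a, rfl, rfl, by simp⟩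
  | @tail b c _ hbc ih =>
    obtain ⟨n, t, h0, hn, hR⟩ := ih
    refine ⟨n + 1, fun i => if i ≤ n then t i else c, by simp [h0], by simp, fun i hi => ?_⟩
    rcases (Nat.lt_succ_iff.1 hi).eq_or_lt with rfl | h
    · simp [hn, hbc]
    · simp [h.le, Nat.succ_le_of_lt h, hR i h]

/-- Cousin's lemma. -/
theorem exists_isFinePartition {δ : ℝ → ℝ} {a b : ℝ} (hab : a ≤ b)
    (hδ : ∀ t ∈ Icc a b, 0 < δ t) : ∃ n s τ, IsFinePartition δ a b n s τ := by
  have key := reflTransGen_of_eventually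
    (R := fun x y => ∃ τ ∈ Icc x y, Icc x y ⊆ Ioo (τ - δ τ) (τ + δ τ)) hab
    (fun c hc => by
      have h0 := hδ c ⟨hc.1.le, hc.2⟩
      filter_upwards [Ioo_mem_nhdsLT (show c - δ c < c by linarith)] with x hx _
      exact ⟨c, ⟨hx.2.le, le_rfl⟩, fun y hy => ⟨hx.1.trans_le hy.1, by linarith [hy.2]⟩⟩)
    (fun c hc => by
      have h0 := hδ c ⟨hc.1, hc.2.le⟩
      filter_upwards [Ioo_mem_nhdsGT (show c < c + δ c by linarith)] with x hx _
      exact ⟨c, ⟨le_rfl, hx.1.le⟩, fun y hy => ⟨by linarith [hy.1], hy.2.trans_lt hx.2⟩⟩)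
  obtain ⟨n, t, h0, hn, hR⟩ := exists_sequence_of_reflTransGen key
  have : ∀ i, ∃ τ, i < n → τ ∈ Icc (t i) (t (i + 1)) ∧
      Icc (t i) (t (i + 1)) ⊆ Ioo (τ - δ τ) (τ + δ τ) := fun i => by
    by_cases hi : i < n
    · obtain ⟨-, -, -, τ, h⟩ := hR i hi
      exact ⟨τ, fun _ => h⟩
    · exact ⟨0, fun h => absurd h hi⟩
  choose τ hτ using this
  exact ⟨n, t, τ, h0, hn, fun i hi => (hR i hi).2.1, fun i hi => (hτ i hi).1,
    fun i hi => (hτ i hi).2⟩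

theorem IsFinePartition.mono {δ δ' : ℝ → ℝ} {a b : ℝ} {n : ℕ} {s τ : ℕ → ℝ}
    (h : IsFinePartition δ a b n s τ) (hδ : ∀ t, δ t ≤ δ' t) : IsFinePartition δ' a b n s τ :=
  ⟨h.1, h.2, h.3, h.4, fun i hi x hx =>
    ⟨by linarith [(h.5 i hi hx).1, hδ (τ i)], by linarith [(h.5 i hi hx).2, hδ (τ i)]⟩⟩

theorem IsFinePartition.mem_Icc {δ : ℝ → ℝ} {a b : ℝ} {n : ℕ} {s τ : ℕ → ℝ}
    (h : IsFinePartition δ a b n s τ) {i : ℕ} (hi : i ≤ n) : s i ∈ Icc a b := by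
  have hm : ∀ j k, j ≤ k → k ≤ n → s j ≤ s k := fun j k hjk => by
    induction k, hjk using Nat.le_induction with
    | base => simp
    | succ k _ ih => exact fun hk => (ih (by omega)).trans (h.lt k (by omega)).le
  exact ⟨h.left_end ▸ hm 0 i (by omega) hi, h.right_end ▸ hm i n hi le_rfl⟩

theorem IsFinePartition.tag_mem_Icc {δ : ℝ → ℝ} {a b : ℝ} {n : ℕ} {s τ : ℕ → ℝ}
    (h : IsFinePartition δ a b n s τ) {i : ℕ} (hi : i < n) : τ i ∈ Icc a b :=
  ⟨(h.mem_Icc hi.le).1.trans (h.tag_mem i hi).1, (h.tag_mem i hi).2.trans (h.mem_Icc hi).2⟩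

/-! ### Local bounds for the Kurzweil-Stieltjes integral -/

/-- `G` is a minor function of `f` with respect to `g` on `[a,b]`. -/
structure IsMinor (a b : ℝ) (f g G : ℝ → ℝ) : Prop where
  left : ∀ τ ∈ Ioc a b, ∀ᶠ x in 𝓝[<] τ, a ≤ x → G τ - G x ≤ f τ * (g τ - g x)
  right : ∀ τ ∈ Ico a b, ∀ᶠ y in 𝓝[>] τ, y ≤ b → G y - G τ ≤ f τ * (g y - g τ)

/-- A fine cell splits at its tag into two pieces, on each of which the local inequality at the tag
applies; the increments of `G` then telescope. -/
theorem IsMinor.exists_gauge {a b : ℝ} {f g G : ℝ → ℝ} (h : IsMinor a b f g G) :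
    ∃ δ : ℝ → ℝ, (∀ t ∈ Icc a b, 0 < δ t) ∧
      ∀ (n : ℕ) (s τ : ℕ → ℝ), IsFinePartition δ a b n s τ →
        G b - G a ≤ ∑ i ∈ Finset.range n, f (τ i) * (g (s (i + 1)) - g (s i)) := by
  have h1 : ∀ τ, ∃ d > 0, τ ∈ Icc a b → ∀ x, a ≤ x → x ≤ τ → τ - d < x →
      G τ - G x ≤ f τ * (g τ - g x) := fun τ => by
    by_cases hτ : τ ∈ Ioc a b
    · obtain ⟨l, hl, hl'⟩ := (mem_nhdsLT_iff_exists_Ioo_subset).1 (h.left τ hτ)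
      refine ⟨τ - l, sub_pos.2 hl, fun _ x hax hxτ hx => ?_⟩
      rcases hxτ.eq_or_lt with rfl | hxτ
      · simp
      · exact hl' ⟨by linarith, hxτ⟩ hax
    · refine ⟨1, one_pos, fun h x hax hxτ _ => ?_⟩
      have : τ = a := le_antisymm (not_lt.1 fun h' => hτ ⟨h', h.2⟩) h.1
      have : x = τ := le_antisymm hxτ (this ▸ hax)
      simp [this]
  have h2 : ∀ τ, ∃ d > 0, τ ∈ Icc a b → ∀ x, x ≤ b → τ ≤ x → x < τ + d →
      G x - G τ ≤ f τ * (g x - g τ) := fun τ => by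
    by_cases hτ : τ ∈ Ico a b
    · obtain ⟨l, hl, hl'⟩ := (mem_nhdsGT_iff_exists_Ioo_subset).1 (h.right τ hτ)
      refine ⟨l - τ, sub_pos.2 hl, fun _ x hax hxτ hx => ?_⟩
      rcases hxτ.eq_or_lt with rfl | hxτ
      · simp
      · exact hl' ⟨hxτ, by linarith⟩ hax
    · refine ⟨1, one_pos, fun h x hax hxτ _ => ?_⟩
      have : τ = b := le_antisymm h.2 (not_lt.1 fun h' => hτ ⟨h.1, h'⟩)
      have : x = τ := le_antisymm (this ▸ hax) hxτ
      simp [this]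
  choose d1 hd1 h1 using h1
  choose d2 hd2 h2 using h2
  refine ⟨fun t => min (d1 t) (d2 t), fun t _ => lt_min (hd1 t) (hd2 t), fun n s τ hp => ?_⟩
  rw [← hp.left_end, ← hp.right_end, ← Finset.sum_range_sub (fun i => G (s i))]
  refine Finset.sum_le_sum fun i hi => ?_
  have hi := Finset.mem_range.1 hi
  have hτ := hp.tag_mem_Icc hi
  have e1 := h1 (τ i) hτ (s i) (hp.mem_Icc hi.le).1 (hp.tag_mem i hi).1 (by
    linarith [(hp.fine i hi (left_mem_Icc.2 (hp.lt i hi).le)).1, min_le_left (d1 (τ i)) (d2 (τ i))])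
  have e2 := h2 (τ i) hτ (s (i + 1)) (hp.mem_Icc hi).2 (hp.tag_mem i hi).2 (by
    linarith [(hp.fine i hi (right_mem_Icc.2 (hp.lt i hi).le)).2,
      min_le_right (d1 (τ i)) (d2 (τ i))])
  linarith

theorem HasKSIntegral.exists_partition {f g : ℝ → ℝ} {a b I : ℝ} (h : HasKSIntegral f g a b I)
    {ε : ℝ} (hε : 0 < ε) {δ : ℝ → ℝ} (hδ : ∀ t ∈ Icc a b, 0 < δ t) (hab : a ≤ b) :
    ∃ n s τ, IsFinePartition δ a b n s τ ∧
      |(∑ i ∈ Finset.range n, f (τ i) * (g (s (i + 1)) - g (s i))) - I| < ε := by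
  obtain ⟨δ', hδ', H⟩ := h ε hε
  obtain ⟨n, s, τ, hp⟩ := exists_isFinePartition (δ := fun t => min (δ t) (δ' t)) hab
    fun t ht => lt_min (hδ t ht) (hδ' t ht)
  exact ⟨n, s, τ, hp.mono fun t => min_le_left _ _, H n s τ (hp.mono fun t => min_le_right _ _)⟩

theorem IsMinor.le_integral {a b I : ℝ} {f g G : ℝ → ℝ} (h : IsMinor a b f g G) (hab : a ≤ b)
    (hI : HasKSIntegral f g a b I) : G b - G a ≤ I := by
  obtain ⟨δ, hδ, H⟩ := h.exists_gauge
  refine le_of_forall_pos_le_add fun ε hε => ?_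
  obtain ⟨n, s, τ, hp, hlt⟩ := hI.exists_partition hε hδ hab
  linarith [H n s τ hp, (abs_lt.1 hlt).2]

theorem HasKSIntegral.sub_integrator {f g₁ g₂ : ℝ → ℝ} {a b I₁ I₂ : ℝ}
    (h₁ : HasKSIntegral f g₁ a b I₁) (h₂ : HasKSIntegral f g₂ a b I₂) :
    HasKSIntegral f (fun t => g₁ t - g₂ t) a b (I₁ - I₂) := fun ε hε => by
  obtain ⟨δ₁, hδ₁, H₁⟩ := h₁ (ε / 2) (by linarith)
  obtain ⟨δ₂, hδ₂, H₂⟩ := h₂ (ε / 2) (by linarith)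
  refine ⟨fun t => min (δ₁ t) (δ₂ t), fun t ht => lt_min (hδ₁ t ht) (hδ₂ t ht),
    fun n s τ hp => ?_⟩
  have e₁ := H₁ n s τ (hp.mono fun t => min_le_left _ _)
  have e₂ := H₂ n s τ (hp.mono fun t => min_le_right _ _)
  have : ∑ i ∈ Finset.range n, f (τ i) * (g₁ (s (i + 1)) - g₂ (s (i + 1)) - (g₁ (s i) - g₂ (s i)))
      = ∑ i ∈ Finset.range n, f (τ i) * (g₁ (s (i + 1)) - g₁ (s i)) -
        ∑ i ∈ Finset.range n, f (τ i) * (g₂ (s (i + 1)) - g₂ (s i)) := by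
    rw [← Finset.sum_sub_distrib]
    exact Finset.sum_congr rfl fun i _ => by ring
  rw [this]
  rw [abs_lt] at *
  constructor <;> linarith

theorem HasKSIntegral.neg_left {f g : ℝ → ℝ} {a b I : ℝ} (h : HasKSIntegral f g a b I) :
    HasKSIntegral (fun t => -f t) g a b (-I) := fun ε hε => by
  obtain ⟨δ, hδ, H⟩ := h ε hε
  refine ⟨δ, hδ, fun n s τ hp => ?_⟩
  rw [← abs_neg]
  convert H n s τ hp using 2
  simp only [neg_mul, Finset.sum_neg_distrib]
  ring

/-- Perron's criterion: a minor function for `-g` is, up to sign, a major function for `g`, so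
Riemann sums are trapped between two increments that differ by at most `ε`. The integral is the
supremum of the increments of minor functions. -/
theorem exists_hasKSIntegral_of_isMinor {a b : ℝ} {f g : ℝ → ℝ} (hab : a ≤ b)
    (h : ∀ ε > 0, ∃ G H, IsMinor a b f g G ∧ IsMinor a b f (fun t => -g t) H ∧
      -ε ≤ (G b - G a) + (H b - H a)) : ∃ I, HasKSIntegral f g a b I := by
  have hle : ∀ G H, IsMinor a b f g G → IsMinor a b f (fun t => -g t) H →
      G b - G a ≤ -(H b - H a) := fun G H hG hH => by
    obtain ⟨δ₁, hδ₁, H₁⟩ := hG.exists_gauge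
    obtain ⟨δ₂, hδ₂, H₂⟩ := hH.exists_gauge
    obtain ⟨n, s, τ, hp⟩ := exists_isFinePartition (δ := fun t => min (δ₁ t) (δ₂ t)) hab
      fun t ht => lt_min (hδ₁ t ht) (hδ₂ t ht)
    have e₁ := H₁ n s τ (hp.mono fun t => min_le_left _ _)
    have e₂ := H₂ n s τ (hp.mono fun t => min_le_right _ _)
    have : ∑ i ∈ Finset.range n, f (τ i) * (-g (s (i + 1)) - -g (s i)) =
        -∑ i ∈ Finset.range n, f (τ i) * (g (s (i + 1)) - g (s i)) := by
      rw [← Finset.sum_neg_distrib]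
      exact Finset.sum_congr rfl fun i _ => by ring
    linarith
  set S := {x | ∃ G, IsMinor a b f g G ∧ G b - G a = x}
  obtain ⟨G₀, H₀, hG₀, hH₀, -⟩ := h 1 one_pos
  have hbdd : BddAbove S := ⟨_, by rintro x ⟨G, hG, rfl⟩; exact hle G H₀ hG hH₀⟩
  refine ⟨sSup S, fun ε hε => ?_⟩
  obtain ⟨G, H, hG, hH, hGH⟩ := h (ε / 2) (by linarith)
  have e₃ : G b - G a ≤ sSup S := le_csSup hbdd ⟨G, hG, rfl⟩
  have e₄ : sSup S ≤ -(H b - H a) :=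
    csSup_le ⟨_, G, hG, rfl⟩ (by rintro x ⟨G, hG, rfl⟩; exact hle G H hG hH)
  obtain ⟨δ₁, hδ₁, H₁⟩ := hG.exists_gauge
  obtain ⟨δ₂, hδ₂, H₂⟩ := hH.exists_gauge
  refine ⟨fun t => min (δ₁ t) (δ₂ t), fun t ht => lt_min (hδ₁ t ht) (hδ₂ t ht),
    fun n s τ hp => ?_⟩
  have e₁ := H₁ n s τ (hp.mono fun t => min_le_left _ _)
  have e₂ := H₂ n s τ (hp.mono fun t => min_le_right _ _)
  have : ∑ i ∈ Finset.range n, f (τ i) * (-g (s (i + 1)) - -g (s i)) =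
      -∑ i ∈ Finset.range n, f (τ i) * (g (s (i + 1)) - g (s i)) := by
    rw [← Finset.sum_neg_distrib]
    exact Finset.sum_congr rfl fun i _ => by ring
  rw [abs_lt]
  constructor <;> linarith

theorem IsMinor.glue {a b c : ℝ} {f g G₁ G₂ : ℝ → ℝ} (h₁ : IsMinor a b f g G₁)
    (h₂ : IsMinor b c f g G₂) :
    IsMinor a c f g (fun t => if t ≤ b then G₁ t else G₁ b + (G₂ t - G₂ b)) := by
  refine ⟨fun τ hτ => ?_, fun τ hτ => ?_⟩
  · rcases le_or_gt τ b with h | h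
    · filter_upwards [h₁.left τ ⟨hτ.1, h⟩, self_mem_nhdsWithin] with x hx (hxτ : x < τ) hax
      simpa [h, hxτ.le.trans h] using hx hax
    · filter_upwards [h₂.left τ ⟨h, hτ.2⟩, Ioo_mem_nhdsLT h] with x hx hxτ hax
      simpa [not_le.2 h, not_le.2 hxτ.1] using hx hxτ.1.le
  · rcases lt_or_ge τ b with h | h
    · filter_upwards [h₁.right τ ⟨hτ.1, h⟩, Ioo_mem_nhdsGT h] with x hx hxτ hax
      simpa [h.le, hxτ.2.le] using hx hxτ.2.le
    · filter_upwards [h₂.right τ ⟨h, hτ.2⟩, self_mem_nhdsWithin] with x hx (hxτ : τ < x) hax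
      rcases h.eq_or_lt with rfl | h
      · simpa [not_le.2 hxτ] using hx hax
      · simpa [not_le.2 h, not_le.2 (h.trans hxτ)] using hx hax

/-- Inside the cell `c g - ε V` is a minor function. The value `f x` is uncontrolled, but `g` is
right-continuous at `x`, so a drop by `η` just after `x` suffices; at `y` the jump of `g` is
weighted by `f y`, and a second `η` pays for the left limit. The terms in `c` and `f y` cancel when
the result is added to its analogue for `-g`. -/
theorem exists_isMinor_of_near_const {x y c l ε η : ℝ} {f g V : ℝ → ℝ} (hxy : x < y)
    (hf : ∀ t ∈ Ioo x y, |f t - c| ≤ ε) (hη : 0 < η)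
    (hgx : Tendsto g (𝓝[>] x) (𝓝 (g x))) (hgy : Tendsto g (𝓝[<] y) (𝓝 l))
    (hV : ∀ s ∈ Icc x y, ∀ t ∈ Icc x y, s ≤ t → |g t - g s| ≤ V t - V s) (hε : 0 ≤ ε) :
    ∃ G, IsMinor x y f g G ∧
      G y - G x = c * (l - g x) + f y * (g y - l) - ε * (V y - V x) - 2 * η := by
  have hmul : ∀ s ∈ Icc x y, ∀ t ∈ Icc x y, s ≤ t → ∀ d, |d| ≤ ε →
      d * (g t - g s) ≤ ε * (V t - V s) := fun s hs t ht hst d hd => by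
    calc d * (g t - g s) ≤ |d * (g t - g s)| := le_abs_self _
      _ = |d| * |g t - g s| := abs_mul _ _
      _ ≤ _ := mul_le_mul hd (hV s hs t ht hst) (abs_nonneg _) hε
  refine ⟨fun t => if t < y then c * g t - ε * V t - (if x < t then η else 0) else
    c * l + f y * (g y - l) - ε * V y - 2 * η, ⟨fun τ hτ => ?_, fun τ hτ => ?_⟩, ?_⟩
  · rcases hτ.2.lt_or_eq with h | rfl
    · filter_upwards [Ioo_mem_nhdsLT hτ.1] with s hs _
      simp only [h, if_true, hτ.1, hs.1, hs.2.trans h]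
      have := hmul s ⟨hs.1.le, (hs.2.trans h).le⟩ τ ⟨hτ.1.le, h.le⟩ hs.2.le (c - f τ)
        (by rw [abs_sub_comm]; exact hf τ ⟨hτ.1, h⟩)
      linarith
    · have : Tendsto (fun s => (c - f τ) * (l - g s)) (𝓝[<] τ) (𝓝 ((c - f τ) * (l - l))) :=
        (hgy.const_sub l).const_mul _
      rw [sub_self, mul_zero] at this
      filter_upwards [Ioo_mem_nhdsLT hτ.1, this.eventually (gt_mem_nhds hη)] with s hs hs' _
      simp only [lt_irrefl, if_false, hs.2, if_true, hs.1]
      have := mul_le_mul_of_nonneg_left ((abs_nonneg _).trans (hV s ⟨hs.1.le, hs.2.le⟩ τ ⟨hxy.le, le_rfl⟩ hs.2.le)) hε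
      linarith
  · rcases hτ.1.lt_or_eq with h | rfl
    · filter_upwards [Ioo_mem_nhdsGT hτ.2] with s hs _
      simp only [h, if_true, hτ.2, hs.2, h.trans hs.1]
      have := hmul τ ⟨h.le, hτ.2.le⟩ s ⟨(h.trans hs.1).le, hs.2.le⟩ hs.1.le (c - f τ)
        (by rw [abs_sub_comm]; exact hf τ ⟨h, hτ.2⟩)
      linarith
    · have : Tendsto (fun s => (c - f x) * (g s - g x)) (𝓝[>] x) (𝓝 ((c - f x) * (g x - g x))) :=
        (hgx.sub_const _).const_mul _
      rw [sub_self, mul_zero] at this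
      filter_upwards [Ioo_mem_nhdsGT hτ.2, this.eventually (gt_mem_nhds hη)] with s hs hs' _
      simp only [lt_irrefl, if_false, hs.2, if_true, hs.1, hτ.2]
      have := mul_le_mul_of_nonneg_left ((abs_nonneg _).trans (hV x ⟨le_rfl, hxy.le⟩ s ⟨hs.1.le, hs.2.le⟩ hs.1.le)) hε
      linarith
  · simp only [lt_irrefl, if_false, hxy, if_true]
    ring

/-- A regulated `f` is nearly constant on the open cells of some division, so the minor functions of
these cells can be glued. The budget `η` is halved at each cell, so the number of cells does not
matter. -/
theorem exists_hasKSIntegral {T : ℝ} (hT : 0 ≤ T) {f g V : ℝ → ℝ} (hf : Regulated T f)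
    (hg : RightRegulated T g)
    (hV : ∀ s ∈ Icc 0 T, ∀ t ∈ Icc 0 T, s ≤ t → |g t - g s| ≤ V t - V s) :
    ∃ I, HasKSIntegral f g 0 T I := by
  have key : ∀ ε > 0, ∀ η > 0, ∃ G H, IsMinor 0 T f g G ∧ IsMinor 0 T f (fun t => -g t) H ∧
      -(2 * ε * (V T - V 0)) - η ≤ (G T - G 0) + (H T - H 0) := fun ε hε => by
    have hc := reflTransGen_of_eventually (R := fun x y => ∃ c, ∀ t ∈ Ioo x y, |f t - c| ≤ ε) hT
      (fun c hc => by
        obtain ⟨l, hl⟩ := hf.left_lim c hc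
        obtain ⟨x, hx, hx'⟩ := (mem_nhdsLT_iff_exists_Ioo_subset).1
          (hl.eventually (Metric.closedBall_mem_nhds l hε))
        filter_upwards [Ioo_mem_nhdsLT hx] with z hz _
        exact ⟨l, fun t ht => by simpa [Real.dist_eq] using hx' ⟨hz.1.trans ht.1, ht.2⟩⟩)
      (fun c hc => by
        obtain ⟨l, hl⟩ := hf.right_lim c hc
        obtain ⟨x, hx, hx'⟩ := (mem_nhdsGT_iff_exists_Ioo_subset).1
          (hl.eventually (Metric.closedBall_mem_nhds l hε))
        filter_upwards [Ioo_mem_nhdsGT hx] with z hz _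
        exact ⟨l, fun t ht => by simpa [Real.dist_eq] using hx' ⟨ht.1, ht.2.trans hz.2⟩⟩)
    suffices H : ∀ b, Relation.ReflTransGen (fun x y => 0 ≤ x ∧ x < y ∧ y ≤ T ∧
        ∃ c, ∀ t ∈ Ioo x y, |f t - c| ≤ ε) 0 b → ∀ η > 0, ∃ G H, IsMinor 0 b f g G ∧
        IsMinor 0 b f (fun t => -g t) H ∧
        -(2 * ε * (V b - V 0)) - η ≤ (G b - G 0) + (H b - H 0) from H T hc
    intro b hb
    induction hb with
    | refl =>
      exact fun η hη => ⟨0, 0, ⟨fun τ hτ => absurd hτ (by simp), fun τ hτ => absurd hτ (by simp)⟩,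
        ⟨fun τ hτ => absurd hτ (by simp), fun τ hτ => absurd hτ (by simp)⟩, by simp [hη.le]⟩
    | @tail x y hx hxy ih =>
      intro η hη
      obtain ⟨G₁, H₁, hG₁, hH₁, h₁⟩ := ih (η / 2) (by linarith)
      obtain ⟨h0x, hxy, hyT, c, hc⟩ := hxy
      obtain ⟨l, hl⟩ := hg.left_lim y ⟨h0x.trans_lt hxy, hyT⟩
      have hgx := hg.right_cont x ⟨h0x, hxy.trans_le hyT⟩
      have hV' : ∀ s ∈ Icc x y, ∀ t ∈ Icc x y, s ≤ t → |g t - g s| ≤ V t - V s :=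
        fun s hs t ht => hV s ⟨h0x.trans hs.1, hs.2.trans hyT⟩ t ⟨h0x.trans ht.1, ht.2.trans hyT⟩
      obtain ⟨G₂, hG₂, e₂⟩ := exists_isMinor_of_near_const (η := η / 8) hxy hc (by linarith)
        hgx hl hV' hε.le
      obtain ⟨H₂, hH₂, e₃⟩ := exists_isMinor_of_near_const (η := η / 8) (V := V) hxy hc
        (by linarith) hgx.neg hl.neg (fun s hs t ht hst => by
          rw [show -g t - -g s = -(g t - g s) by ring, abs_neg]; exact hV' s hs t ht hst) hε.le
      refine ⟨_, _, hG₁.glue hG₂, hH₁.glue hH₂, ?_⟩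
      simp only [not_le.2 hxy, if_false, h0x, if_true]
      linarith
  refine exists_hasKSIntegral_of_isMinor hT fun ε hε => ?_
  have hV0 : 0 ≤ V T - V 0 :=
    (abs_nonneg _).trans (hV 0 ⟨le_rfl, hT⟩ T ⟨hT, le_rfl⟩ hT)
  obtain ⟨G, H, hG, hH, h⟩ := key (ε / (4 * (V T - V 0 + 1))) (by positivity) (ε / 2) (by linarith)
  refine ⟨G, H, hG, hH, le_trans ?_ h⟩
  have : 2 * (ε / (4 * (V T - V 0 + 1))) * (V T - V 0) ≤ ε / 2 := by
    rw [show 2 * (ε / (4 * (V T - V 0 + 1))) * (V T - V 0) =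
      ε / 2 * ((V T - V 0) / (V T - V 0 + 1)) by field_simp; ring]
    exact mul_le_of_le_one_right (by linarith) (div_le_one_of_le₀ (by linarith) (by linarith))
  linarith

/-! ### Bounded variation and approximation by constants on intervals -/

theorem exists_dominating_of_boundedVariationOn {a b : ℝ} (hab : a ≤ b) {g : ℝ → ℝ}
    (hg : BoundedVariationOn g (Icc a b)) :
    ∃ V : ℝ → ℝ, ∀ s ∈ Icc a b, ∀ t ∈ Icc a b, s ≤ t → |g t - g s| ≤ V t - V s := by
  have hl := hg.locallyBoundedVariationOn
  exact ⟨variationOnFromTo g (Icc a b) a, fun s hs t ht hst =>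
    variationOnFromTo.abs_sub_le_sub_of_le hl (left_mem_Icc.2 hab) hs ht hst⟩

theorem boundedVariationOn_of_dominating {s : Set ℝ} {g V : ℝ → ℝ} {C : ℝ}
    (hV : ∀ x ∈ s, ∀ y ∈ s, x ≤ y → |g y - g x| ≤ V y - V x) (hC : ∀ x ∈ s, |V x| ≤ C) :
    BoundedVariationOn g s := by
  have hmono : MonotoneOn V s := fun x hx y hy hxy =>
    sub_nonneg.1 ((abs_nonneg _).trans (hV x hx y hy hxy))
  have hb := hmono.boundedVariationOn hC
  refine ne_top_of_le_ne_top hb (iSup_le fun p => le_trans (Finset.sum_le_sum fun i _ => ?_)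
    (eVariationOn.sum_le (f := V) (s := s) p.2.2.1 p.2.2.2 (n := p.1)))
  have hi := p.2.2.1 (Nat.le_succ i)
  rw [edist_dist, edist_dist, Real.dist_eq, Real.dist_eq]
  exact ENNReal.ofReal_le_ofReal
    ((hV _ (p.2.2.2 i) _ (p.2.2.2 (i + 1)) hi).trans (le_abs_self _))

/-- Right-continuous interval-wise approximation by constants. -/
theorem RightRegulated.exists_partition {F : Type*} [PseudoMetricSpace F] {T t₀ : ℝ} {f : ℝ → F}
    (hf : RightRegulated T f) (ht₀ : t₀ ∈ Icc 0 T) {ε : ℝ} (hε : 0 < ε) :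
    ∃ (n : ℕ) (t : ℕ → ℝ), t 0 = 0 ∧ t n = t₀ ∧
      ∀ i < n, t i < t (i + 1) ∧ ∀ s ∈ Ico (t i) (t (i + 1)), dist (f s) (f (t i)) ≤ ε := by
  have hc := reflTransGen_of_eventually
      (R := fun x y => ∀ t ∈ Ico x y, dist (f t) (f x) ≤ ε) ht₀.1
      (fun c hc => by
        obtain ⟨l, hl⟩ := hf.left_lim c ⟨hc.1, hc.2.trans ht₀.2⟩
        obtain ⟨x, hx, hx'⟩ := (mem_nhdsLT_iff_exists_Ioo_subset).1
          (hl.eventually (Metric.closedBall_mem_nhds l (half_pos hε)))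
        filter_upwards [Ioo_mem_nhdsLT hx] with z hz _ t ht
        have e1 : dist (f t) l ≤ ε / 2 := hx' ⟨hz.1.trans_le ht.1, ht.2⟩
        have e2 : dist (f z) l ≤ ε / 2 := hx' hz
        linarith [dist_triangle_right (f t) (f z) l])
      (fun c hc => by
        have hl := hf.right_cont c ⟨hc.1, hc.2.trans_le ht₀.2⟩
        obtain ⟨x, hx, hx'⟩ := (mem_nhdsGT_iff_exists_Ioo_subset).1
          (hl.eventually (Metric.closedBall_mem_nhds (f c) hε))
        filter_upwards [Ioo_mem_nhdsGT hx] with z hz _ t ht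
        rcases ht.1.eq_or_lt with rfl | h
        · simpa using hε.le
        · exact hx' ⟨h, ht.2.trans hz.2⟩)
  obtain ⟨n, t, h0, hn, h⟩ := exists_sequence_of_reflTransGen hc
  exact ⟨n, t, h0, hn, fun i hi => ⟨(h i hi).2.1, (h i hi).2.2.2⟩⟩

/-! ### An explicit formula for the play -/

/-- The projection of `k` onto the interval `[x - r, x + r]`. -/
def clip (x r k : ℝ) : ℝ := max (x - r) (min k (x + r))

theorem sub_le_clip (x r k : ℝ) : x - r ≤ clip x r k := le_max_left _ _

theorem clip_le_add {r : ℝ} (hr : 0 ≤ r) (x k : ℝ) : clip x r k ≤ x + r :=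
  max_le (by linarith) (min_le_right _ _)

theorem clip_eq_self {x r k : ℝ} (h : |x - k| ≤ r) : clip x r k = k := by
  rw [abs_le] at h
  rw [clip, min_eq_left (by linarith), max_eq_right (by linarith)]

theorem clip_eq_sub_of_lt {x r k : ℝ} (h : k < clip x r k) : clip x r k = x - r := by
  rw [clip, lt_max_iff] at h
  rcases h with h | h
  · exact max_eq_left ((min_le_left _ _).trans h.le)
  · exact absurd h (not_lt.2 (min_le_left _ _))

theorem clip_eq_add_of_lt {x r k : ℝ} (hr : 0 ≤ r) (h : clip x r k < k) : clip x r k = x + r := by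
  rw [clip] at h ⊢
  have : min k (x + r) < k := (le_max_right _ _).trans_lt h
  have : x + r < k := by simpa using this
  rw [min_eq_right this.le, max_eq_right (by linarith)]

theorem clip_sub_clip_le {x y r s k l d : ℝ} (h₁ : (x - r) - (y - s) ≤ d) (h₂ : k - l ≤ d)
    (h₃ : (x + r) - (y + s) ≤ d) : clip x r k - clip y s l ≤ d := by
  have : clip x r k ≤ clip y s l + d := max_le
    (by linarith [sub_le_clip y s l]) (by
      have : min k (x + r) ≤ min l (y + s) + d := by
        rw [← min_add_add_right]
        exact min_le_min (by linarith) (by linarith)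
      exact this.trans (by gcongr; exact le_max_right _ _))
  linarith

theorem abs_clip_sub_clip_le {x y r k l d : ℝ} (h₁ : |x - y| ≤ d) (h₂ : |k - l| ≤ d) :
    |clip x r k - clip y r l| ≤ d := by
  rw [abs_le] at *
  have e₁ : clip x r k - clip y r l ≤ d :=
    clip_sub_clip_le (by linarith) (by linarith) (by linarith)
  have e₂ : clip y r l - clip x r k ≤ d :=
    clip_sub_clip_le (by linarith) (by linarith) (by linarith)
  constructor <;> linarith

theorem continuous_clip (x r : ℝ) : Continuous (clip x r) := by
  unfold clip; fun_prop

/-- The levels below the value at time `b` of the play with threshold `r` and input `q` that starts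
at time `a` in the state `x`. -/
def playLevels (r : ℝ) (q : ℝ → ℝ) (a x b : ℝ) : Set ℝ :=
  {v | (v ≤ x ∧ ∀ τ ∈ Icc a b, v ≤ q τ + r) ∨
    ∃ σ ∈ Icc a b, v ≤ q σ - r ∧ ∀ τ ∈ Icc σ b, v ≤ q τ + r}

/-- The value at time `b` of the play with threshold `r` and input `q` that starts at time `a` in
the state `x`. -/
noncomputable def playFrom (r : ℝ) (q : ℝ → ℝ) (a x b : ℝ) : ℝ := sSup (playLevels r q a x b)

/-! ### Contraction and semigroup properties of the play -/

section playFrom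

variable {r a b c x v : ℝ} {q : ℝ → ℝ}

theorem playLevels_mono {v' : ℝ} (hv : v ∈ playLevels r q a x b) (h : v' ≤ v) :
    v' ∈ playLevels r q a x b := by
  rcases hv with ⟨h₁, h₂⟩ | ⟨σ, hσ, h₁, h₂⟩
  · exact .inl ⟨h.trans h₁, fun τ hτ => h.trans (h₂ τ hτ)⟩
  · exact .inr ⟨σ, hσ, h.trans h₁, fun τ hτ => h.trans (h₂ τ hτ)⟩

theorem le_add_of_mem_playLevels (hab : a ≤ b) (hv : v ∈ playLevels r q a x b) : v ≤ q b + r := by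
  rcases hv with ⟨_, h₂⟩ | ⟨σ, hσ, _, h₂⟩
  · exact h₂ b ⟨hab, le_rfl⟩
  · exact h₂ b ⟨hσ.2, le_rfl⟩

theorem bddAbove_playLevels (hab : a ≤ b) : BddAbove (playLevels r q a x b) :=
  ⟨_, fun _ hv => le_add_of_mem_playLevels hab hv⟩

theorem sub_mem_playLevels (hr : 0 ≤ r) (hab : a ≤ b) : q b - r ∈ playLevels r q a x b :=
  .inr ⟨b, ⟨hab, le_rfl⟩, le_rfl, fun τ hτ => by
    rw [le_antisymm hτ.2 hτ.1]; linarith⟩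

theorem le_playFrom (hab : a ≤ b) (hv : v ∈ playLevels r q a x b) : v ≤ playFrom r q a x b :=
  le_csSup (bddAbove_playLevels hab) hv

theorem mem_playLevels_of_lt (hr : 0 ≤ r) (hab : a ≤ b) (hv : v < playFrom r q a x b) :
    v ∈ playLevels r q a x b := by
  obtain ⟨w, hw, hvw⟩ := exists_lt_of_lt_csSup ⟨_, sub_mem_playLevels hr hab⟩ hv
  exact playLevels_mono hw hvw.le

theorem playFrom_le (hr : 0 ≤ r) (hab : a ≤ b) {y : ℝ}
    (h : ∀ v ∈ playLevels r q a x b, v ≤ y) : playFrom r q a x b ≤ y :=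
  csSup_le ⟨_, sub_mem_playLevels hr hab⟩ h

theorem abs_sub_playFrom_le (hr : 0 ≤ r) (hab : a ≤ b) : |q b - playFrom r q a x b| ≤ r := by
  have h₁ : q b - r ≤ playFrom r q a x b := le_playFrom hab (sub_mem_playLevels hr hab)
  have h₂ : playFrom r q a x b ≤ q b + r :=
    playFrom_le hr hab fun v hv => le_add_of_mem_playLevels hab hv
  rw [abs_le]
  constructor <;> linarith

/-- Lowering a level by `ε` compensates for a change of input and initial state by `ε`. This makes
the play nonexpansive in the sup norm. -/
theorem playFrom_le_add {q' : ℝ → ℝ} {x' ε : ℝ} (hr : 0 ≤ r) (hab : a ≤ b)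
    (hq : ∀ t ∈ Icc a b, |q' t - q t| ≤ ε) (hx : x' ≤ x + ε) :
    playFrom r q' a x' b ≤ playFrom r q a x b + ε := by
  refine playFrom_le hr hab fun v hv => ?_
  suffices v - ε ∈ playLevels r q a x b by linarith [le_playFrom hab this]
  have hq' : ∀ t ∈ Icc a b, q' t ≤ q t + ε := fun t ht => by linarith [(abs_le.1 (hq t ht)).2]
  rcases hv with ⟨h₁, h₂⟩ | ⟨σ, hσ, h₁, h₂⟩
  · exact .inl ⟨by linarith, fun τ hτ => by linarith [h₂ τ hτ, hq' τ hτ]⟩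
  · exact .inr ⟨σ, hσ, by linarith [hq' σ hσ], fun τ hτ => by
      linarith [h₂ τ hτ, hq' τ ⟨hσ.1.trans hτ.1, hτ.2⟩]⟩

theorem abs_playFrom_sub_le {q' : ℝ → ℝ} {x' ε : ℝ} (hr : 0 ≤ r) (hab : a ≤ b)
    (hq : ∀ t ∈ Icc a b, |q' t - q t| ≤ ε) (hx : |x' - x| ≤ ε) :
    |playFrom r q' a x' b - playFrom r q a x b| ≤ ε := by
  rw [abs_le] at hx
  have h₁ := playFrom_le_add (x := x) (x' := x') hr hab hq (by linarith)
  have h₂ := playFrom_le_add (q := q') (q' := q) (x := x') (x' := x) hr hab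
    (fun t ht => by rw [abs_sub_comm]; exact hq t ht) (by linarith)
  rw [abs_le]
  constructor <;> linarith

theorem playFrom_trans (hr : 0 ≤ r) (hab : a ≤ b) (hbc : b ≤ c) :
    playFrom r q b (playFrom r q a x b) c = playFrom r q a x c := by
  refine le_antisymm (playFrom_le hr hbc fun v hv => ?_)
    (playFrom_le hr (hab.trans hbc) fun v hv => le_playFrom hbc ?_)
  · rcases hv with ⟨h₁, h₂⟩ | ⟨σ, hσ, h₁, h₂⟩
    -- The supremum `playFrom r q a x b` need not be a level itself, hence the passage to strictly
    -- smaller `v'`.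
    · refine le_of_forall_lt_imp_le_of_dense fun v' hv' =>
        le_playFrom (hab.trans hbc) ?_
      rcases mem_playLevels_of_lt hr hab (hv'.trans_le h₁) with ⟨h₃, h₄⟩ | ⟨σ, hσ, h₃, h₄⟩
      · refine .inl ⟨h₃, fun τ hτ => ?_⟩
        rcases le_total τ b with h | h
        · exact h₄ τ ⟨hτ.1, h⟩
        · exact hv'.le.trans (h₂ τ ⟨h, hτ.2⟩)
      · refine .inr ⟨σ, ⟨hσ.1, hσ.2.trans hbc⟩, h₃, fun τ hτ => ?_⟩
        rcases le_total τ b with h | h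
        · exact h₄ τ ⟨hτ.1, h⟩
        · exact hv'.le.trans (h₂ τ ⟨h, hτ.2⟩)
    · exact le_playFrom (hab.trans hbc) (.inr ⟨σ, ⟨hab.trans hσ.1, hσ.2⟩, h₁, h₂⟩)
  · rcases hv with ⟨h₁, h₂⟩ | ⟨σ, hσ, h₁, h₂⟩
    · exact .inl ⟨le_playFrom hab (.inl ⟨h₁, fun τ hτ => h₂ τ ⟨hτ.1, hτ.2.trans hbc⟩⟩),
        fun τ hτ => h₂ τ ⟨hab.trans hτ.1, hτ.2⟩⟩
    · rcases le_total σ b with h | h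
      · exact .inl ⟨le_playFrom hab
          (.inr ⟨σ, ⟨hσ.1, h⟩, h₁, fun τ hτ => h₂ τ ⟨hτ.1, hτ.2.trans hbc⟩⟩),
          fun τ hτ => h₂ τ ⟨h.trans hτ.1, hτ.2⟩⟩
      · exact .inr ⟨σ, ⟨h, hσ.2⟩, h₁, h₂⟩

/-- An admissible state does not move while the input is constant, so only the projection at the
final time `b` acts. For `a = b` admissibility is not required, which covers the initial condition.
-/
theorem playFrom_of_const {d : ℝ} (hr : 0 ≤ r) (hab : a ≤ b) (hq : ∀ t ∈ Ico a b, q t = d)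
    (hx : a < b → |d - x| ≤ r) : playFrom r q a x b = clip (q b) r x := by
  refine le_antisymm (playFrom_le hr hab fun v hv => ?_) (le_playFrom hab ?_)
  · rcases hv with ⟨h₁, h₂⟩ | ⟨σ, hσ, h₁, h₂⟩
    · exact (le_min h₁ (h₂ b ⟨hab, le_rfl⟩)).trans (le_max_right _ _)
    · rcases hσ.2.eq_or_lt with h | h
      · exact (h ▸ h₁).trans (le_max_left _ _)
      · have := abs_le.1 (hx (hσ.1.trans_lt h))
        rw [hq σ ⟨hσ.1, h⟩] at h₁
        exact (le_min (by linarith) (h₂ b ⟨hσ.2, le_rfl⟩)).trans (le_max_right _ _)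
  · rcases le_total (q b - r) (min x (q b + r)) with h | h
    · rw [clip, max_eq_right h]
      refine .inl ⟨min_le_left _ _, fun τ hτ => ?_⟩
      rcases hτ.2.eq_or_lt with h' | h'
      · exact h' ▸ min_le_right _ _
      · rw [hq τ ⟨hτ.1, h'⟩]
        have := abs_le.1 (hx (hτ.1.trans_lt h'))
        exact (min_le_left _ _).trans (by linarith)
    · rw [clip, max_eq_left h]
      exact sub_mem_playLevels hr hab

theorem abs_playFrom_sub_clip_le {ε : ℝ} (hr : 0 ≤ r) (hab : a ≤ b) (hε : 0 ≤ ε)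
    (hq : ∀ t ∈ Ico a b, |q t - q a| ≤ ε) (hx : |q a - x| ≤ r) :
    |playFrom r q a x b - clip (q b) r x| ≤ ε := by
  have := playFrom_of_const (q := fun t => if t < b then q a else q b) (d := q a) (x := x) hr hab
    (fun t ht => if_pos ht.2) (fun _ => hx)
  simp only [lt_irrefl, if_false] at this
  rw [← this]
  refine abs_playFrom_sub_le hr hab (fun t ht => ?_) (by simpa using hε)
  split_ifs with h
  · exact hq t ⟨ht.1, h⟩
  · rw [le_antisymm ht.2 (not_lt.1 h)]
    simpa using hε

theorem abs_playFrom_sub_start_le {ε : ℝ} (hr : 0 ≤ r) (hab : a ≤ b) (hε : 0 ≤ ε)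
    (hq : ∀ t ∈ Icc a b, |q t - q a| ≤ ε) (hx : |q a - x| ≤ r) :
    |playFrom r q a x b - x| ≤ ε := by
  have := playFrom_of_const (q := fun _ => q a) (d := q a) (x := x) hr hab
    (fun t _ => rfl) (fun _ => hx)
  rw [clip_eq_self hx] at this
  calc |playFrom r q a x b - x| = |playFrom r q a x b - playFrom r (fun _ => q a) a x b| := by
        rw [this]
    _ ≤ ε := abs_playFrom_sub_le hr hab hq (by simpa using hε)

end playFrom

/-- The play with threshold `r` and input `q`, started at time `0` in the state `0`. -/
noncomputable def explicitPlay (r : ℝ) (q : ℝ → ℝ) (t : ℝ) : ℝ := playFrom r q 0 0 t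

/-! ### Level crossings and monotonicity of the play started at time zero -/

section explicitPlay

variable {r a b t T : ℝ} {q : ℝ → ℝ}

theorem explicitPlay_zero (hr : 0 ≤ r) : explicitPlay r q 0 = clip (q 0) r 0 :=
  playFrom_of_const (d := 0) hr le_rfl (fun t ht => absurd ht (by simp)) fun h => absurd h (lt_irrefl _)

theorem explicitPlay_eq_playFrom (hr : 0 ≤ r) (ha : 0 ≤ a) (hab : a ≤ b) :
    explicitPlay r q b = playFrom r q a (explicitPlay r q a) b :=
  (playFrom_trans hr ha hab).symm

theorem abs_sub_explicitPlay_le (hr : 0 ≤ r) (ht : 0 ≤ t) : |q t - explicitPlay r q t| ≤ r :=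
  abs_sub_playFrom_le hr ht

theorem abs_explicitPlay_sub_le {q' : ℝ → ℝ} {ε : ℝ} (hr : 0 ≤ r) (ht : 0 ≤ t) (hε : 0 ≤ ε)
    (h : ∀ s ∈ Icc 0 t, |q' s - q s| ≤ ε) : |explicitPlay r q' t - explicitPlay r q t| ≤ ε :=
  abs_playFrom_sub_le hr ht h (by simpa using hε)

theorem explicitPlay_of_const {d : ℝ} (hr : 0 ≤ r) (ha : 0 ≤ a) (hab : a ≤ b)
    (hq : ∀ t ∈ Ico a b, q t = d) : explicitPlay r q b = clip (q b) r (explicitPlay r q a) := by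
  rw [explicitPlay_eq_playFrom hr ha hab]
  exact playFrom_of_const hr hab hq fun h => by
    rw [← hq a ⟨le_rfl, h⟩]; exact abs_sub_explicitPlay_le hr ha

theorem abs_explicitPlay_sub_clip_le {ε : ℝ} (hr : 0 ≤ r) (ha : 0 ≤ a) (hab : a ≤ b) (hε : 0 ≤ ε)
    (hq : ∀ t ∈ Ico a b, |q t - q a| ≤ ε) :
    |explicitPlay r q b - clip (q b) r (explicitPlay r q a)| ≤ ε := by
  rw [explicitPlay_eq_playFrom hr ha hab]
  exact abs_playFrom_sub_clip_le hr hab hε hq (abs_sub_explicitPlay_le hr ha)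

theorem abs_explicitPlay_sub_start_le {ε : ℝ} (hr : 0 ≤ r) (ha : 0 ≤ a) (hab : a ≤ b) (hε : 0 ≤ ε)
    (hq : ∀ t ∈ Icc a b, |q t - q a| ≤ ε) : |explicitPlay r q b - explicitPlay r q a| ≤ ε := by
  rw [explicitPlay_eq_playFrom hr ha hab]
  exact abs_playFrom_sub_start_le hr hab hε hq (abs_sub_explicitPlay_le hr ha)

/-- The play crosses a level upwards only when pushed by the lower barrier `q - r`; the next lemma
is the downward counterpart with `q + r`. -/
theorem exists_le_sub_of_lt_explicitPlay {v : ℝ} (hr : 0 ≤ r) (ha : 0 ≤ a) (hab : a ≤ b)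
    (h₁ : explicitPlay r q a < v) (h₂ : v < explicitPlay r q b) : ∃ σ ∈ Icc a b, v ≤ q σ - r := by
  rw [explicitPlay_eq_playFrom hr ha hab] at h₂
  rcases mem_playLevels_of_lt hr hab h₂ with ⟨h, _⟩ | ⟨σ, hσ, h, _⟩
  · exact absurd h (not_le.2 h₁)
  · exact ⟨σ, hσ, h⟩

theorem exists_add_lt_of_explicitPlay_lt {v : ℝ} (hr : 0 ≤ r) (ha : 0 ≤ a) (hab : a ≤ b)
    (h₁ : explicitPlay r q b < v) (h₂ : v ≤ explicitPlay r q a) : ∃ σ ∈ Icc a b, q σ + r < v := by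
  rw [explicitPlay_eq_playFrom hr ha hab] at h₁
  by_contra! h
  exact absurd (le_playFrom hab (.inl ⟨h₂, h⟩)) (not_le.2 h₁)

/-- To move both up and down, the play must be pushed by both barriers, at levels that force `q` to
oscillate by more than `2 r`. This is the source of bounded variation. -/
theorem monotoneOn_or_antitoneOn_explicitPlay (hr : 0 ≤ r) {J : Set ℝ} (hJ : J.OrdConnected)
    (h0 : ∀ t ∈ J, 0 ≤ t) (hq : ∀ s ∈ J, ∀ t ∈ J, q s - q t ≤ 2 * r) :
    MonotoneOn (explicitPlay r q) J ∨ AntitoneOn (explicitPlay r q) J := by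
  by_contra! h
  simp only [MonotoneOn, AntitoneOn, not_forall, not_le] at h
  obtain ⟨⟨s, hs, t, ht, hst, hlt⟩, s', hs', t', ht', hst', hlt'⟩ := h
  obtain ⟨τ, hτ, h₁⟩ := exists_add_lt_of_explicitPlay_lt hr (h0 s hs) hst hlt le_rfl
  obtain ⟨v, hv⟩ := exists_between hlt'
  obtain ⟨σ, hσ, h₂⟩ := exists_le_sub_of_lt_explicitPlay hr (h0 s' hs') hst' hv.1 hv.2
  have hτJ := hJ.out hs ht hτ
  have hσJ := hJ.out hs' ht' hσ
  have h₃ := hq σ hσJ τ hτJ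
  -- By `h₃`, the state at `s'` lies below `v` and the state at `s` lies above it. The play
  -- therefore has to cross between `s'` and `s` in one direction or the other, and this crossing
  -- gives an oscillation above `2 r`.
  rcases le_total s' s with h | h
  · obtain ⟨w, hw⟩ := exists_between h₁
    obtain ⟨σ', hσ', h₄⟩ := exists_le_sub_of_lt_explicitPlay hr (h0 s' hs') h (v := w)
      (by linarith [hv.1, hw.1]) hw.2
    linarith [hq σ' (hJ.out hs' hs hσ') τ hτJ, hw.1]
  · obtain ⟨τ', hτ', h₄⟩ := exists_add_lt_of_explicitPlay_lt hr (h0 s hs) h hv.1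
      (by linarith)
    linarith [hq σ hσJ τ' (hJ.out hs hs' hτ')]

end explicitPlay

/-! ### Regulated functions and the regularity of the play -/

section Regularity

variable {r T : ℝ} {q : ℝ → ℝ}

theorem Regulated.sub {f g : ℝ → ℝ} (hf : Regulated T f) (hg : Regulated T g) :
    Regulated T fun t => f t - g t :=
  ⟨fun t ht => by
    obtain ⟨l, hl⟩ := hf.right_lim t ht
    obtain ⟨m, hm⟩ := hg.right_lim t ht
    exact ⟨_, hl.sub hm⟩, fun t ht => by
    obtain ⟨l, hl⟩ := hf.left_lim t ht
    obtain ⟨m, hm⟩ := hg.left_lim t ht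
    exact ⟨_, hl.sub hm⟩⟩

theorem RightRegulated.mk' {F : Type*} [TopologicalSpace F] {f : ℝ → F}
    (hl : ∀ t ∈ Ioc 0 T, ∃ l, Tendsto f (𝓝[<] t) (𝓝 l))
    (hr : ∀ t ∈ Ico 0 T, Tendsto f (𝓝[>] t) (𝓝 (f t))) : RightRegulated T f :=
  ⟨⟨fun t ht => ⟨f t, hr t ht⟩, hl⟩, hr⟩

theorem exists_tendsto_of_forall_dist_le {α F : Type*} [PseudoMetricSpace F] [CompleteSpace F]
    {l : Filter α} [l.NeBot] {f : α → F}
    (h : ∀ ε > 0, ∃ s ∈ l, ∀ x ∈ s, ∀ y ∈ s, dist (f x) (f y) ≤ ε) :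
    ∃ z, Tendsto f l (𝓝 z) := by
  refine cauchy_map_iff_exists_tendsto.1 (Metric.cauchy_iff.2 ⟨inferInstance, fun ε hε => ?_⟩)
  obtain ⟨s, hs, H⟩ := h (ε / 2) (by linarith)
  refine ⟨f '' s, image_mem_map hs, ?_⟩
  rintro _ ⟨x, hx, rfl⟩ _ ⟨y, hy, rfl⟩
  exact (H x hx y hy).trans_lt (by linarith)

theorem exists_Ioo_dist_le {F : Type*} [PseudoMetricSpace F] {f : ℝ → F} {c : ℝ} {l : F}
    (h : Tendsto f (𝓝[<] c) (𝓝 l)) {ε : ℝ} (hε : 0 < ε) {b : ℝ} (hb : b < c) :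
    ∃ x, b ≤ x ∧ x < c ∧ ∀ s ∈ Ioo x c, ∀ t ∈ Ioo x c, dist (f s) (f t) ≤ ε := by
  obtain ⟨x, hx, hx'⟩ := (mem_nhdsLT_iff_exists_Ioo_subset).1
    (h.eventually (Metric.closedBall_mem_nhds l (half_pos hε)))
  refine ⟨max b x, le_max_left _ _, max_lt hb hx, fun s hs t ht => ?_⟩
  have e₁ : dist (f s) l ≤ ε / 2 := hx' ⟨(le_max_right _ _).trans_lt hs.1, hs.2⟩
  have e₂ : dist (f t) l ≤ ε / 2 := hx' ⟨(le_max_right _ _).trans_lt ht.1, ht.2⟩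
  linarith [dist_triangle_right (f s) (f t) l]

theorem exists_Ico_dist_le {F : Type*} [PseudoMetricSpace F] {f : ℝ → F} {c : ℝ}
    (h : Tendsto f (𝓝[>] c) (𝓝 (f c))) {ε : ℝ} (hε : 0 < ε) :
    ∃ x, c < x ∧ ∀ s ∈ Ico c x, dist (f s) (f c) ≤ ε := by
  obtain ⟨x, hx, hx'⟩ := (mem_nhdsGT_iff_exists_Ioo_subset).1
    (h.eventually (Metric.closedBall_mem_nhds (f c) hε))
  refine ⟨x, hx, fun s hs => ?_⟩
  rcases hs.1.eq_or_lt with rfl | h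
  · simpa using hε.le
  · exact hx' ⟨h, hs.2⟩

theorem rightRegulated_of_uniform_approx {F : Type*} [PseudoMetricSpace F] [CompleteSpace F]
    {f : ℝ → F} (h : ∀ ε > 0, ∃ g, RightRegulated T g ∧ ∀ t ∈ Icc 0 T, dist (g t) (f t) ≤ ε) :
    RightRegulated T f := by
  refine .mk' (fun c hc => exists_tendsto_of_forall_dist_le fun ε hε => ?_) fun c hc => ?_
  · obtain ⟨g, hg, H⟩ := h (ε / 3) (by linarith)
    obtain ⟨l, hl⟩ := hg.left_lim c hc
    obtain ⟨x, h0x, hxc, hx⟩ := exists_Ioo_dist_le hl (show 0 < ε / 3 by linarith) hc.1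
    refine ⟨Ioo x c, Ioo_mem_nhdsLT hxc, fun s hs t ht => ?_⟩
    have e₁ := H s ⟨h0x.trans hs.1.le, hs.2.le.trans hc.2⟩
    have e₂ := H t ⟨h0x.trans ht.1.le, ht.2.le.trans hc.2⟩
    have e₃ := hx s hs t ht
    have := dist_triangle4 (f s) (g s) (g t) (f t)
    rw [dist_comm (f s) (g s)] at this
    linarith
  · refine Metric.tendsto_nhds.2 fun ε hε => ?_
    obtain ⟨g, hg, H⟩ := h (ε / 4) (by linarith)
    obtain ⟨x, hcx, hx⟩ := exists_Ico_dist_le (hg.right_cont c hc) (show 0 < ε / 4 by linarith)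
    filter_upwards [Ioo_mem_nhdsGT (lt_min hcx hc.2)] with s hs
    have e₁ := H s ⟨hc.1.trans hs.1.le, hs.2.le.trans (min_le_right _ _)⟩
    have e₂ := H c ⟨hc.1, hc.2.le⟩
    have e₃ := hx s ⟨hs.1.le, hs.2.trans_le (min_le_left _ _)⟩
    have := dist_triangle4 (f s) (g s) (g c) (f c)
    rw [dist_comm (f s) (g s)] at this
    linarith

theorem RightRegulated.explicitPlay (hr : 0 ≤ r) (hq : RightRegulated T q) :
    RightRegulated T (explicitPlay r q) := by
  refine .mk' (fun c hc => exists_tendsto_of_forall_dist_le fun ε hε => ?_) fun c hc => ?_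
  · obtain ⟨l, hl⟩ := hq.left_lim c hc
    obtain ⟨x, h0x, hxc, hx⟩ := exists_Ioo_dist_le hl hε hc.1
    have key : ∀ s ∈ Ioo x c, ∀ t ∈ Ioo x c, s ≤ t →
        dist (Preisach.explicitPlay r q t) (Preisach.explicitPlay r q s) ≤ ε :=
      fun s hs t ht hst => abs_explicitPlay_sub_start_le hr (h0x.trans hs.1.le) hst hε.le
        fun y hy => hx y ⟨hs.1.trans_le hy.1, hy.2.trans_lt ht.2⟩ s hs
    refine ⟨Ioo x c, Ioo_mem_nhdsLT hxc, fun s hs t ht => ?_⟩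
    rcases le_total s t with h | h
    · rw [dist_comm]; exact key s hs t ht h
    · exact key t ht s hs h
  · refine Metric.tendsto_nhds.2 fun ε hε => ?_
    obtain ⟨x, hcx, hx⟩ := exists_Ico_dist_le (hq.right_cont c hc) (show 0 < ε / 2 by linarith)
    filter_upwards [Ioo_mem_nhdsGT hcx] with s hs
    exact (abs_explicitPlay_sub_start_le hr hc.1 hs.1.le (half_pos hε).le
        fun y hy => hx y ⟨hy.1, hy.2.trans_lt hs.2⟩).trans_lt (by linarith)

theorem boundedVariationOn_Icc_of_monotoneOn_Ico {f : ℝ → ℝ} {x y B : ℝ}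
    (hf : MonotoneOn f (Ico x y)) (hB : ∀ t ∈ Icc x y, |f t| ≤ B) :
    BoundedVariationOn f (Icc x y) := by
  -- At `y` the function may jump by up to `2 * B` in either direction; from any value at most `B`,
  -- the value `3 * B` dominates that jump.
  refine boundedVariationOn_of_dominating (V := fun t => if t < y then f t else 3 * B)
    (C := 3 * B) (fun s hs t ht hst => ?_) fun t ht => ?_
  · have h₁ := abs_le.1 (hB s hs)
    have h₂ := abs_le.1 (hB t ht)
    rcases ht.2.lt_or_eq with h | h
    · simp only [h, hst.trans_lt h, if_true]
      rw [abs_of_nonneg (sub_nonneg.2 (hf ⟨hs.1, hst.trans_lt h⟩ ⟨ht.1, h⟩ hst))]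
    · rcases hs.2.lt_or_eq with h' | h'
      · simp only [h, h', lt_irrefl, if_true, if_false]
        rw [h] at h₂
        rw [abs_le]
        constructor <;> linarith
      · simp [h, h']
  · have h₁ := abs_le.1 (hB t ht)
    have : 0 ≤ B := by linarith
    split_ifs
    · exact (hB t ht).trans (by linarith)
    · rw [abs_of_nonneg (by linarith)]

theorem boundedVariationOn_Icc_of_antitoneOn_Ico {f : ℝ → ℝ} {x y B : ℝ}
    (hf : AntitoneOn f (Ico x y)) (hB : ∀ t ∈ Icc x y, |f t| ≤ B) :
    BoundedVariationOn f (Icc x y) := by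
  have h := boundedVariationOn_Icc_of_monotoneOn_Ico (f := fun t => -f t) (B := B) hf.neg
    (by simpa using hB)
  obtain hxy | hxy := lt_or_ge y x
  · exact .of_subsingleton (by simp [hxy])
  obtain ⟨V, hV⟩ := exists_dominating_of_boundedVariationOn hxy h
  refine boundedVariationOn_of_dominating (V := fun t => V t - V x) (C := V y - V x)
    (fun s hs t ht hst => ?_) fun t ht => ?_
  · have := hV s hs t ht hst
    rw [show -f t - -f s = -(f t - f s) by ring, abs_neg] at this
    linarith
  · have h₁ := (abs_nonneg _).trans (hV x ⟨le_rfl, hxy⟩ t ht ht.1)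
    have h₂ := (abs_nonneg _).trans (hV t ht y ⟨hxy, le_rfl⟩ ht.2)
    rw [abs_of_nonneg h₁]
    linarith

theorem RightRegulated.exists_bound {F : Type*} [SeminormedAddCommGroup F] {f : ℝ → F}
    (hT : 0 ≤ T) (hf : RightRegulated T f) : ∃ B, 0 ≤ B ∧ ∀ t ∈ Icc 0 T, ‖f t‖ ≤ B := by
  obtain ⟨n, t, h0, hn, h⟩ := hf.exists_partition (right_mem_Icc.2 hT) one_pos
  have : ∀ i ≤ n, ∃ B, 0 ≤ B ∧ ∀ s ∈ Icc 0 (t i), ‖f s‖ ≤ B := fun i => by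
    induction i with
    | zero => exact fun _ => ⟨‖f 0‖, norm_nonneg _, fun s hs => by
        rw [h0] at hs; rw [le_antisymm hs.2 hs.1]⟩
    | succ i ih =>
      intro hi
      obtain ⟨B, hB0, hB⟩ := ih (by omega)
      refine ⟨max B (max (‖f (t i)‖ + 1) ‖f (t (i + 1))‖), le_max_of_le_left hB0, fun s hs => ?_⟩
      rcases le_total s (t i) with h' | h'
      · exact (hB s ⟨hs.1, h'⟩).trans (le_max_left _ _)
      rcases hs.2.lt_or_eq with h'' | h''
      · have := (h i (by omega)).2 s ⟨h', h''⟩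
        rw [dist_eq_norm] at this
        refine le_max_of_le_right (le_max_of_le_left ?_)
        linarith [norm_le_norm_add_norm_sub' (f s) (f (t i))]
      · rw [h'']
        exact le_max_of_le_right (le_max_right _ _)
  obtain ⟨B, hB⟩ := this n le_rfl
  exact ⟨B, hn ▸ hB⟩

/-- Divide `[0,T]` so that `q` stays within `r` of its left value on each half-open cell. Its
oscillation there is at most `2 r`, so the play is monotone on each cell, with a bounded jump at the
end. -/
theorem boundedVariationOn_explicitPlay (hT : 0 ≤ T) (hr : 0 < r) (hq : RightRegulated T q) :
    BoundedVariationOn (explicitPlay r q) (Icc 0 T) := by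
  obtain ⟨B, hB0, hB⟩ := (hq.explicitPlay hr.le).exists_bound hT
  obtain ⟨n, t, h0, hn, h⟩ := hq.exists_partition (right_mem_Icc.2 hT) hr
  have hmono : ∀ i j, i ≤ j → j ≤ n → t i ≤ t j := fun i j hij => by
    induction j, hij using Nat.le_induction with
    | base => simp
    | succ k _ ih => exact fun hk => (ih (by omega)).trans (h k (by omega)).1.le
  have : ∀ i ≤ n, BoundedVariationOn (explicitPlay r q) (Icc 0 (t i)) := fun i => by
    induction i with
    | zero => exact fun _ => .of_subsingleton (by simp [h0])
    | succ i ih =>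
      intro hi
      have hti : 0 ≤ t i := h0 ▸ hmono 0 i (by omega) (by omega)
      have hi' := h i (by omega)
      have hB' : ∀ s ∈ Icc (t i) (t (i + 1)), |explicitPlay r q s| ≤ B :=
        fun s hs => hB s ⟨hti.trans hs.1, hs.2.trans (hn ▸ hmono (i + 1) n hi le_rfl)⟩
      have h₂ : BoundedVariationOn (explicitPlay r q) (Icc (t i) (t (i + 1))) := by
        rcases monotoneOn_or_antitoneOn_explicitPlay (q := q) hr.le
          (ordConnected_Ico (a := t i) (b := t (i + 1))) (fun s hs => hti.trans hs.1)
          (fun s hs s' hs' => by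
            have e₁ := abs_le.1 (hi'.2 s hs)
            have e₂ := abs_le.1 (hi'.2 s' hs')
            linarith) with hm | hm
        · exact boundedVariationOn_Icc_of_monotoneOn_Ico hm hB'
        · exact boundedVariationOn_Icc_of_antitoneOn_Ico hm hB'
      have := eVariationOn.Icc_add_Icc (explicitPlay r q) (s := univ) hti hi'.1.le (mem_univ _)
      simp only [univ_inter] at this
      rw [BoundedVariationOn, ← this]
      exact ENNReal.add_ne_top.2 ⟨ih (by omega), h₂⟩
  exact hn ▸ this n le_rfl

end Regularity

/-! ### The variational inequality: the explicit play solves it, and solutions are unique -/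

section VariationalInequality

variable {r T : ℝ} {q z : ℝ → ℝ}

/-- If the play has risen, `q - r` touched levels up to its final value, so that value is at most `q
τ - r + ε`; the play itself oscillates by at most `ε` after `τ`. Hence `q τ - ξ τ ≥ r - 2 ε`, and
symmetrically when it has fallen. -/
theorem neg_le_mul_explicitPlay_sub {s t τ ε : ℝ} (hr : 0 ≤ r) (hs : 0 ≤ s) (hst : s ≤ t)
    (hτ : τ ∈ Icc s t) (hq : ∀ x ∈ Icc s t, ∀ y ∈ Icc s t, |q x - q y| ≤ ε) (hz : |z τ| ≤ r) :
    -(2 * ε * |explicitPlay r q t - explicitPlay r q s|) ≤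
      (q τ - explicitPlay r q τ - z τ) * (explicitPlay r q t - explicitPlay r q s) := by
  have hε : 0 ≤ ε := by simpa using hq s ⟨le_rfl, hst⟩ s ⟨le_rfl, hst⟩
  have hosc : |explicitPlay r q t - explicitPlay r q τ| ≤ ε :=
    abs_explicitPlay_sub_start_le hr (hs.trans hτ.1) hτ.2 hε fun y hy =>
      hq y ⟨hτ.1.trans hy.1, hy.2⟩ τ hτ
  rw [abs_le] at hosc hz
  rcases lt_trichotomy (explicitPlay r q s) (explicitPlay r q t) with h | h | h
  · have h₁ : explicitPlay r q t ≤ q τ + ε - r := by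
      by_contra! hlt
      obtain ⟨v, hv⟩ := exists_between (max_lt h hlt)
      obtain ⟨σ, hσ, h₂⟩ := exists_le_sub_of_lt_explicitPlay hr hs hst
        ((le_max_left _ _).trans_lt hv.1) hv.2
      linarith [(le_max_right _ _).trans_lt hv.1, (abs_le.1 (hq σ hσ τ hτ)).2]
    rw [abs_of_pos (sub_pos.2 h)]
    nlinarith [sub_pos.2 h]
  · simp [h]
  · have h₁ : q τ - ε + r ≤ explicitPlay r q t := by
      by_contra! hlt
      obtain ⟨v, hv⟩ := exists_between (lt_min h hlt)
      obtain ⟨σ, hσ, h₂⟩ := exists_add_lt_of_explicitPlay_lt hr hs hst hv.1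
        (hv.2.trans_le (min_le_left _ _)).le
      linarith [hv.2.trans_le (min_le_right _ _), (abs_le.1 (hq σ hσ τ hτ)).1]
    rw [abs_of_neg (sub_neg.2 h)]
    nlinarith [sub_neg.2 h]

theorem explicitPlay_eq_clip_of_tendsto {y l : ℝ} (hr : 0 ≤ r) (hy : y ∈ Ioc 0 T)
    (hq : RightRegulated T q) (hl : Tendsto (explicitPlay r q) (𝓝[<] y) (𝓝 l)) :
    explicitPlay r q y = clip (q y) r l := by
  have h₁ : Tendsto (fun s => explicitPlay r q y - clip (q y) r (explicitPlay r q s)) (𝓝[<] y)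
      (𝓝 (explicitPlay r q y - clip (q y) r l)) :=
    (((continuous_clip _ _).tendsto l).comp hl).const_sub _
  have h₂ : Tendsto (fun s => explicitPlay r q y - clip (q y) r (explicitPlay r q s)) (𝓝[<] y)
      (𝓝 0) := by
    refine Metric.tendsto_nhds.2 fun ε hε => ?_
    obtain ⟨m, hm⟩ := hq.left_lim y hy
    obtain ⟨x, h0x, hxy, hx⟩ := exists_Ioo_dist_le hm (half_pos hε) hy.1
    filter_upwards [Ioo_mem_nhdsLT hxy] with s hs
    rw [dist_zero_right]
    exact (abs_explicitPlay_sub_clip_le hr (h0x.trans hs.1.le) hs.2.le (half_pos hε).le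
      fun t ht => hx t ⟨hs.1.trans_le ht.1, ht.2⟩ s hs).trans_lt (by linarith)
  exact sub_eq_zero.1 (tendsto_nhds_unique h₁ h₂)

/-- Inside the cell the small oscillation of `q` makes `-2 ε V` a minor function. At `y` the input
may jump, but there the play is the projection of its left limit, so the jump term is nonnegative in
the limit; the drop `η` absorbs the limit. -/
theorem exists_isMinor_explicitPlay {x y ε η : ℝ} {V : ℝ → ℝ} (hr : 0 ≤ r)
    (hq : RightRegulated T q) (hx : 0 ≤ x) (hxy : x < y) (hyT : y ≤ T) (hη : 0 < η) (hε : 0 ≤ ε)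
    (hosc : ∀ s ∈ Ico x y, ∀ t ∈ Ico x y, |q s - q t| ≤ ε) (hz : ∀ t ∈ Icc 0 T, |z t| ≤ r)
    (hV : ∀ s ∈ Icc 0 T, ∀ t ∈ Icc 0 T, s ≤ t →
      |explicitPlay r q t - explicitPlay r q s| ≤ V t - V s) :
    ∃ G, IsMinor x y (fun t => q t - explicitPlay r q t - z t) (explicitPlay r q) G ∧
      G y - G x = -(2 * ε * (V y - V x)) - η := by
  have hloc : ∀ s ∈ Ico x y, ∀ t ∈ Ico x y, s ≤ t → ∀ τ ∈ Icc s t, -(2 * ε * (V t - V s)) ≤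
      (q τ - explicitPlay r q τ - z τ) * (explicitPlay r q t - explicitPlay r q s) :=
    fun s hs t ht hst τ hτ => by
      have h₁ := neg_le_mul_explicitPlay_sub hr (hx.trans hs.1) hst hτ
        (fun a ha b hb => hosc a ⟨hs.1.trans ha.1, ha.2.trans_lt ht.2⟩ b
          ⟨hs.1.trans hb.1, hb.2.trans_lt ht.2⟩)
        (hz τ ⟨(hx.trans hs.1).trans hτ.1, (hτ.2.trans ht.2.le).trans hyT⟩)
      have h₂ := mul_le_mul_of_nonneg_left (hV s ⟨hx.trans hs.1, hs.2.le.trans hyT⟩ t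
        ⟨hx.trans ht.1, ht.2.le.trans hyT⟩ hst) (show 0 ≤ 2 * ε by linarith)
      linarith
  refine ⟨fun t => -(2 * ε * V t) - if t < y then 0 else η, ⟨fun τ hτ => ?_, fun τ hτ => ?_⟩, ?_⟩
  · rcases hτ.2.lt_or_eq with h | rfl
    · filter_upwards [Ioo_mem_nhdsLT hτ.1] with s hs _
      simp only [h, if_true, hs.2.trans h]
      linarith [hloc s ⟨hs.1.le, hs.2.trans h⟩ τ ⟨hτ.1.le, h⟩ hs.2.le τ ⟨hs.2.le, le_rfl⟩]
    · have hτ0 : τ ∈ Ioc 0 T := ⟨hx.trans_lt hxy, hyT⟩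
      obtain ⟨l, hl⟩ := (hq.explicitPlay hr).left_lim τ hτ0
      have hclip := explicitPlay_eq_clip_of_tendsto hr hτ0 hq hl
      have hz' := abs_le.1 (hz τ ⟨hτ0.1.le, hyT⟩)
      have hlim : Tendsto (fun s => (q τ - explicitPlay r q τ - z τ) *
          (explicitPlay r q τ - explicitPlay r q s)) (𝓝[<] τ)
          (𝓝 ((q τ - explicitPlay r q τ - z τ) * (explicitPlay r q τ - l))) :=
        (hl.const_sub _).const_mul _
      have h0 : 0 ≤ (q τ - explicitPlay r q τ - z τ) * (explicitPlay r q τ - l) := by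
        rcases lt_trichotomy l (explicitPlay r q τ) with h | h | h
        · have := clip_eq_sub_of_lt (hclip ▸ h)
          rw [← hclip] at this
          exact mul_nonneg (by linarith) (by linarith)
        · simp [h]
        · have := clip_eq_add_of_lt hr (hclip ▸ h)
          rw [← hclip] at this
          exact mul_nonneg_of_nonpos_of_nonpos (by linarith) (by linarith)
      filter_upwards [Ioo_mem_nhdsLT hxy,
        hlim.eventually (lt_mem_nhds (show -η < _ by linarith))] with s hs hs' _
      simp only [lt_irrefl, if_false, hs.2, if_true]
      have := mul_nonneg hε ((abs_nonneg _).trans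
        (hV s ⟨hx.trans hs.1.le, hs.2.le.trans hyT⟩ τ ⟨hτ0.1.le, hyT⟩ hs.2.le))
      linarith
  · filter_upwards [Ioo_mem_nhdsGT hτ.2] with s hs _
    simp only [hτ.2, if_true, hs.2]
    linarith [hloc τ hτ s ⟨hτ.1.trans hs.1.le, hs.2⟩ hs.1.le τ ⟨le_rfl, hs.1.le⟩]
  · simp only [lt_irrefl, if_false, hxy, if_true]
    ring

theorem isPlay_explicitPlay (hT : 0 ≤ T) (hr : 0 < r) (hq : RightRegulated T q) :
    IsPlay T r q (explicitPlay r q) := by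
  have hbv := boundedVariationOn_explicitPlay hT hr hq
  have hreg := hq.explicitPlay hr.le
  refine ⟨hbv, hreg, fun t ht => abs_sub_explicitPlay_le hr.le ht.1, fun z hz hzr => ?_,
    explicitPlay_zero hr.le⟩
  obtain ⟨V, hV⟩ := exists_dominating_of_boundedVariationOn hT hbv
  obtain ⟨I, hI⟩ := exists_hasKSIntegral hT ((hq.toRegulated.sub hreg.toRegulated).sub hz) hreg hV
  refine ⟨I, hI, ?_⟩
  have hV0 : 0 ≤ V T - V 0 := (abs_nonneg _).trans (hV 0 ⟨le_rfl, hT⟩ T ⟨hT, le_rfl⟩ hT)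
  refine le_of_forall_pos_le_add fun ε hε => ?_
  -- Two points of a cell have `q`-values within `2 * ε'`, so the loss is `4 * ε' * (V T - V 0)`, at
  -- most `ε / 2`.
  set ε' := ε / (8 * (V T - V 0 + 1)) with hε'
  have hε'0 : 0 < ε' := by positivity
  obtain ⟨n, t, h0, hn, h⟩ := hq.exists_partition (right_mem_Icc.2 hT) hε'0
  have hmono : ∀ i j, i ≤ j → j ≤ n → t i ≤ t j := fun i j hij => by
    induction j, hij using Nat.le_induction with
    | base => simp
    | succ k _ ih => exact fun hk => (ih (by omega)).trans (h k (by omega)).1.le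
  have key : ∀ i ≤ n, ∀ η > 0, ∃ G,
      IsMinor 0 (t i) (fun t => q t - explicitPlay r q t - z t) (explicitPlay r q) G ∧
      -(4 * ε' * (V (t i) - V 0)) - η ≤ G (t i) - G 0 := fun i => by
    induction i with
    | zero =>
      intro _ η hη
      rw [h0]
      exact ⟨0, ⟨fun τ hτ => absurd hτ (by simp), fun τ hτ => absurd hτ (by simp)⟩, by simp [hη.le]⟩
    | succ i ih =>
      intro hi η hη
      obtain ⟨G₁, hG₁, h₁⟩ := ih (by omega) (η / 2) (by linarith)
      have hti : 0 ≤ t i := h0 ▸ hmono 0 i (by omega) (by omega)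
      obtain ⟨hlt, hosc⟩ := h i (by omega)
      obtain ⟨G₂, hG₂, h₂⟩ := exists_isMinor_explicitPlay (z := z) (η := η / 2) (ε := 2 * ε')
        hr.le hq hti hlt (hn ▸ hmono (i + 1) n hi le_rfl) (by linarith) (by linarith)
        (fun s hs s' hs' => by
          have := dist_triangle_right (q s) (q s') (q (t i))
          rw [← Real.dist_eq]
          linarith [hosc s hs, hosc s' hs']) hzr hV
      refine ⟨_, hG₁.glue hG₂, ?_⟩
      simp only [not_le.2 hlt, if_false, hti, if_true]
      linarith
  obtain ⟨G, hG, hle⟩ := key n le_rfl (ε / 2) (by linarith)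
  rw [hn] at hG hle
  have h₁ := hG.le_integral hT hI
  have h₂ : 4 * ε' * (V T - V 0) ≤ ε / 2 := by
    rw [hε', show 4 * (ε / (8 * (V T - V 0 + 1))) * (V T - V 0) =
      ε / 2 * ((V T - V 0) / (V T - V 0 + 1)) by field_simp; ring]
    exact mul_le_of_le_one_right (by linarith) (div_le_one_of_le₀ (by linarith) (by linarith))
  linarith

/-- Testing each solution with the other gives `∫ h dh ≤ 0` up to time `t` for `h = ξ - ζ`. For
right-continuous `h` with `h 0 = 0` this integral is at least `h t ^ 2 / 2`, because jumps from the
left only add to it. -/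
theorem IsPlay.eq_of_isPlay {ξ ζ : ℝ → ℝ} (hq : RightRegulated T q)
    (hξ : IsPlay T r q ξ) (hζ : IsPlay T r q ζ) {t : ℝ} (ht : t ∈ Icc 0 T) : ξ t = ζ t := by
  have hT : 0 ≤ T := ht.1.trans ht.2
  -- Test the inequality for `ξ` with `q - ζ` on `[0,t]`.
  have test : ∀ {ξ ζ : ℝ → ℝ}, IsPlay T r q ξ → IsPlay T r q ζ → ∃ I,
      HasKSIntegral (fun s => if s ≤ t then ζ s - ξ s else 0) ξ 0 T I ∧ 0 ≤ I := by
    intro ξ ζ hξ hζ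
    have hA := hq.toRegulated.sub hζ.reg.toRegulated
    have hB := hq.toRegulated.sub hξ.reg.toRegulated
    have hz : Regulated T fun s => if s ≤ t then q s - ζ s else q s - ξ s := by
      refine ⟨fun c hc => ?_, fun c hc => ?_⟩
      · rcases lt_or_ge c t with h | h
        · obtain ⟨l, hl⟩ := hA.right_lim c hc
          refine ⟨l, hl.congr' ?_⟩
          filter_upwards [Ioo_mem_nhdsGT h] with s hs
          rw [if_pos hs.2.le]
        · obtain ⟨l, hl⟩ := hB.right_lim c hc
          refine ⟨l, hl.congr' ?_⟩
          filter_upwards [self_mem_nhdsWithin] with s (hs : c < s)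
          rw [if_neg (not_le.2 (h.trans_lt hs))]
      · rcases le_or_gt c t with h | h
        · obtain ⟨l, hl⟩ := hA.left_lim c hc
          refine ⟨l, hl.congr' ?_⟩
          filter_upwards [self_mem_nhdsWithin] with s (hs : s < c)
          rw [if_pos (hs.le.trans h)]
        · obtain ⟨l, hl⟩ := hB.left_lim c hc
          refine ⟨l, hl.congr' ?_⟩
          filter_upwards [Ioo_mem_nhdsLT h] with s hs
          rw [if_neg (not_le.2 hs.1)]
    obtain ⟨I, hI, h0⟩ := hξ.var_ineq _ hz fun s hs => by
      split_ifs
      · exact hζ.dist_le s hs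
      · exact hξ.dist_le s hs
    refine ⟨I, ?_, h0⟩
    convert hI using 2 with s
    split_ifs <;> ring
  obtain ⟨I₁, hI₁, h₁⟩ := test hξ hζ
  obtain ⟨I₂, hI₂, h₂⟩ := test hζ hξ
  set h := fun s => ξ s - ζ s with hh
  set f := fun s => if s ≤ t then h s else 0 with hf
  -- The integral of `f` against `ξ` is `-I₁` and against `ζ` is `I₂`, so the value here is
  -- nonpositive.
  have hI : HasKSIntegral f h 0 T (-I₁ - I₂) := by
    refine HasKSIntegral.sub_integrator ?_ hI₂
    convert hI₁.neg_left using 2 with s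
    simp only [hf, hh]
    split_ifs <;> ring
  obtain ⟨V₁, hV₁⟩ := exists_dominating_of_boundedVariationOn hT hξ.bv
  obtain ⟨V₂, hV₂⟩ := exists_dominating_of_boundedVariationOn hT hζ.bv
  set V := fun s => V₁ s + V₂ s
  have hV : ∀ x ∈ Icc 0 T, ∀ y ∈ Icc 0 T, x ≤ y → |h y - h x| ≤ V y - V x := fun x hx y hy hxy => by
    have e₁ := hV₁ x hx y hy hxy
    have e₂ := hV₂ x hx y hy hxy
    have := abs_sub (ξ y - ξ x) (ζ y - ζ x)
    rw [show h y - h x = (ξ y - ξ x) - (ζ y - ζ x) by simp only [hh]; ring]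
    simp only [V]
    linarith
  have hVm : ∀ x ∈ Icc 0 T, ∀ y ∈ Icc 0 T, x ≤ y → 0 ≤ V y - V x :=
    fun x hx y hy hxy => (abs_nonneg _).trans (hV x hx y hy hxy)
  have hright : ∀ τ ∈ Ico 0 T, Tendsto (fun y => h y - h τ) (𝓝[>] τ) (𝓝 0) := fun τ hτ => by
    have := ((hξ.reg.right_cont τ hτ).sub (hζ.reg.right_cont τ hτ)).sub_const (h τ)
    rwa [show ξ τ - ζ τ - h τ = 0 from sub_self _] at this
  have key : ∀ ε > 0, h t ^ 2 / 2 ≤ ε * (V T - V 0 + 1) := fun ε hε => by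
    -- Leftward increments follow from `h τ (h τ - h x) ≥ (h τ ^ 2 - h x ^ 2) / 2`. To the right the
    -- square `(h y - h τ) ^ 2` has the wrong sign and is absorbed by `ε V`, by right continuity.
    -- The drop by `ε` after `t` covers the tag `t`, where `f` is still `h t`.
    have hminor : IsMinor 0 T f h
        fun s => h (min s t) ^ 2 / 2 - ε * V s - if t < s then ε else 0 := by
      refine ⟨fun τ hτ => ?_, fun τ hτ => ?_⟩
      · rcases le_or_gt τ t with hτt | hτt
        · filter_upwards [Ioo_mem_nhdsLT hτ.1] with x hx _
          have := mul_nonneg hε.le (hVm x ⟨hx.1.le, hx.2.le.trans hτ.2⟩ τ ⟨hτ.1.le, hτ.2⟩ hx.2.le)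
          simp only [hf, hτt, hx.2.le.trans hτt, min_eq_left, not_lt.2, if_true, if_false]
          nlinarith [sq_nonneg (h τ - h x)]
        · filter_upwards [Ioo_mem_nhdsLT hτt] with x hx _
          have := mul_nonneg hε.le
            (hVm x ⟨ht.1.trans hx.1.le, hx.2.le.trans hτ.2⟩ τ ⟨hτ.1.le, hτ.2⟩ hx.2.le)
          simp only [hf, not_le.2 hτt, hτt, hx.1, hτt.le, hx.1.le, min_eq_right, if_true, if_false]
          linarith
      · rcases lt_trichotomy τ t with hτt | rfl | hτt
        · filter_upwards [Ioo_mem_nhdsGT hτt, (hright τ hτ).eventually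
            (Metric.ball_mem_nhds 0 hε)] with y hy hy' _
          have hyT : y ∈ Icc 0 T := ⟨hτ.1.trans hy.1.le, hy.2.le.trans ht.2⟩
          have h₁ := hV τ ⟨hτ.1, hτ.2.le⟩ y hyT hy.1.le
          have h₂ : |h y - h τ| < ε := by simpa using hy'
          have h₃ : (h y - h τ) ^ 2 ≤ ε * (V y - V τ) := by
            rw [← sq_abs, pow_two]
            exact mul_le_mul h₂.le h₁ (abs_nonneg _) hε.le
          simp only [hf, hτt.le, hy.2.le, min_eq_left, not_lt.2, if_true, if_false]
          nlinarith [sq_nonneg (h y - h τ)]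
        · have hlim := (hright τ hτ).const_mul (h τ)
          rw [mul_zero] at hlim
          filter_upwards [Ioo_mem_nhdsGT hτ.2, hlim.eventually (lt_mem_nhds (neg_lt_zero.2 hε))]
            with y hy hy' _
          have := mul_nonneg hε.le (hVm τ ht y ⟨hτ.1.trans hy.1.le, hy.2.le⟩ hy.1.le)
          simp only [hf, le_refl, lt_irrefl, hy.1, hy.1.le, min_eq_right, if_true, if_false]
          linarith
        · filter_upwards [Ioo_mem_nhdsGT hτ.2] with y hy _
          have := mul_nonneg hε.le
            (hVm τ ⟨hτ.1, hτ.2.le⟩ y ⟨hτ.1.trans hy.1.le, hy.2.le⟩ hy.1.le)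
          simp only [hf, not_le.2 hτt, hτt, hτt.le, hτt.trans hy.1, (hτt.trans hy.1).le,
            min_eq_right, if_true, if_false]
          linarith
    have hle := hminor.le_integral hT hI
    have h00 : h 0 = 0 := by simp only [hh, hξ.init, hζ.init, sub_self]
    simp only [min_eq_right ht.2, min_eq_left ht.1, h00, not_lt.2 ht.1, if_false] at hle
    split_ifs at hle <;> nlinarith
  have hsq : h t ^ 2 / 2 ≤ 0 := by
    refine le_of_forall_pos_le_add fun ε hε => ?_
    have hpos : 0 < V T - V 0 + 1 := by linarith [hVm 0 ⟨le_rfl, hT⟩ T ⟨hT, le_rfl⟩ hT]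
    have := key (ε / (V T - V 0 + 1)) (by positivity)
    rw [div_mul_cancel₀ _ hpos.ne'] at this
    linarith
  have : h t = 0 := pow_eq_zero_iff (two_ne_zero) |>.1 (le_antisymm (by linarith) (sq_nonneg _))
  exact sub_eq_zero.1 this

/-- `play` is an unspecified choice; existence and uniqueness on `[0,T]` make it irrelevant which
solution is chosen. -/
theorem play_eq_explicitPlay (hr : 0 < r) (hq : RightRegulated T q) {t : ℝ} (ht : t ∈ Icc 0 T) :
    play T r q t = explicitPlay r q t :=
  have h := isPlay_explicitPlay (ht.1.trans ht.2) hr hq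
  (Classical.epsilon_spec (p := IsPlay T r q) ⟨_, h⟩).eq_of_isPlay hq h ht

end VariationalInequality

/-! ### The density -/

/-- The exceptional null set of the derivative bound depends on `s`, so the mean value inequality is
not available for fixed `ω`. It is applied instead to `s ↦ ∫_E g s`, for which null sets do not
matter; since `E` is arbitrary, the pointwise bound follows. -/
theorem ae_abs_sub_le_of_abs_deriv_le {Ω : Type*} [MeasurableSpace Ω] {ν : Measure Ω} [SigmaFinite ν]
    {g : ℝ → Ω → ℝ} {k : Ω → ℝ} (hg : ∀ s, AEMeasurable (g s) ν) (hk : Integrable k ν)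
    (hlip : ∀ᵐ ω ∂ν, ∃ C, LipschitzOnWith C (fun s => g s ω) (Icc (-1) 2))
    (hderiv : ∀ s, ∀ᵐ ω ∂ν, DifferentiableAt ℝ (fun s => g s ω) s ∧
      |deriv (fun s => g s ω) s| ≤ k ω) : ∀ᵐ ω ∂ν, |g 1 ω - g 0 ω| ≤ k ω := by
  set Q : Set ℚ := {s | (s : ℝ) ∈ Ioo (-1 : ℝ) 2} with hQ
  -- On `A n` the measure is finite, `g 0` is bounded and the Lipschitz constant is uniform, as
  -- differentiation under the integral requires. Restricting to rational times keeps `A n`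
  -- null-measurable.
  set A : ℕ → Set Ω := fun n => (spanningSets ν n ∩ {ω | |g 0 ω| ≤ n}) ∩
    ⋂ s ∈ Q, ⋂ t ∈ Q, {ω | |g s ω - g t ω| ≤ n * |(s : ℝ) - t|} with hA
  have hAm : ∀ n, NullMeasurableSet (A n) ν := fun n => by
    refine ((measurableSet_spanningSets ν n).nullMeasurableSet.inter ?_).inter ?_
    · exact nullMeasurableSet_le (hg 0).abs aemeasurable_const
    · exact .biInter (to_countable _) fun s _ => .biInter (to_countable _) fun t _ =>
        nullMeasurableSet_le ((hg s).sub (hg t)).abs aemeasurable_const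
  have hdense : Icc (-1 : ℝ) 2 ⊆ closure (Ioo (-1) 2 ∩ range ((↑) : ℚ → ℝ)) := by
    rw [← closure_Ioo (by norm_num : (-1 : ℝ) ≠ 2)]
    exact closure_minimal (Rat.denseRange_cast.open_subset_closure_inter isOpen_Ioo) isClosed_closure
  have hAlip : ∀ n, ∀ᵐ ω ∂ν, ω ∈ A n →
      LipschitzOnWith n (fun s => g s ω) (Icc (-1) 2) := fun n => by
    filter_upwards [hlip] with ω ⟨C, hC⟩ hω
    have hcl : closure (Ioo (-1) 2 ∩ range ((↑) : ℚ → ℝ)) ⊆ Icc (-1) 2 :=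
      closure_minimal (inter_subset_left.trans Ioo_subset_Icc_self) isClosed_Icc
    have h : LipschitzOnWith n (fun s => g s ω) (Ioo (-1) 2 ∩ range ((↑) : ℚ → ℝ)) := by
      refine LipschitzOnWith.of_dist_le_mul ?_
      rintro _ ⟨hs, s, rfl⟩ _ ⟨ht, t, rfl⟩
      have := mem_iInter₂.1 (mem_iInter₂.1 hω.2 s hs) t ht
      simpa [Real.dist_eq] using this
    exact (h.closure (hC.continuousOn.mono hcl)).mono hdense
  have hAcover : ∀ᵐ ω ∂ν, ∃ n, ω ∈ A n := by
    filter_upwards [hlip] with ω ⟨C, hC⟩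
    obtain ⟨n₁, h₁⟩ := mem_iUnion.1 ((iUnion_spanningSets ν).symm ▸ mem_univ ω)
    obtain ⟨n₂, h₂⟩ := exists_nat_ge |g 0 ω|
    obtain ⟨n₃, h₃⟩ := exists_nat_ge (C : ℝ)
    refine ⟨max n₁ (max n₂ n₃), ⟨monotone_spanningSets ν (le_max_left _ _) h₁, h₂.trans ?_⟩, ?_⟩
    · exact_mod_cast (le_max_left _ _).trans (le_max_right _ _)
    · refine mem_iInter₂.2 fun s hs => mem_iInter₂.2 fun t ht => ?_
      have := hC.dist_le_mul s (Ioo_subset_Icc_self hs) t (Ioo_subset_Icc_self ht)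
      refine this.trans (mul_le_mul_of_nonneg_right (h₃.trans ?_) dist_nonneg)
      exact_mod_cast (le_max_right _ _).trans (le_max_right _ _)
  have key : ∀ n, ∀ᵐ ω ∂ν.restrict (A n), |g 1 ω - g 0 ω| ≤ k ω := fun n => by
    set ρ := ν.restrict (A n) with hρ
    have : IsFiniteMeasure ρ := ⟨by
      rw [hρ, Measure.restrict_apply_univ]
      exact (measure_mono (inter_subset_left.trans inter_subset_left)).trans_lt
        (measure_spanningSets_lt_top ν n)⟩
    have hgρ : ∀ s, AEMeasurable (g s) ρ := fun s => (hg s).mono_measure Measure.restrict_le_self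
    have hlipρ : ∀ᵐ ω ∂ρ, LipschitzOnWith n (fun s => g s ω) (Icc (-1) 2) :=
      (ae_restrict_iff'₀ (hAm n)).2 (hAlip n)
    have h0ρ : ∀ᵐ ω ∂ρ, |g 0 ω| ≤ n :=
      (ae_restrict_iff'₀ (hAm n)).2 (.of_forall fun ω hω => hω.1.2)
    have hint : ∀ s ∈ Icc (-1 : ℝ) 2, Integrable (g s) ρ := fun s hs => by
      refine Integrable.of_bound (hgρ s).aestronglyMeasurable (n + n * |s|) ?_
      filter_upwards [hlipρ, h0ρ] with ω h₁ h₂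
      have := h₁.dist_le_mul s hs 0 (by norm_num)
      simp only [Real.dist_eq, sub_zero, NNReal.coe_natCast] at this
      have h₃ := abs_sub_abs_le_abs_sub (g s ω) (g 0 ω)
      rw [Real.norm_eq_abs]
      linarith
    have hkρ : Integrable k ρ := hk.mono_measure Measure.restrict_le_self
    have hset : ∀ E, |∫ ω in E, (g 1 ω - g 0 ω) ∂ρ| ≤ ∫ ω in E, k ω ∂ρ := fun E => by
      have hd : ∀ s ∈ Icc (0 : ℝ) 1, HasDerivAt (fun s => ∫ ω in E, g s ω ∂ρ)
          (∫ ω in E, deriv (fun s => g s ω) s ∂ρ) s := fun s hs => by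
        have hderivs : ∀ᵐ ω ∂ρ.restrict E, HasDerivAt (fun s => g s ω) (deriv (fun s => g s ω) s) s :=
          ae_restrict_of_ae (ae_restrict_of_ae ((hderiv s).mono fun ω h => h.1.hasDerivAt))
        refine (hasDerivAt_integral_of_dominated_loc_of_lip (s := Ioo (-1) 2)
          (Ioo_mem_nhds (by linarith [hs.1]) (by linarith [hs.2]))
          (.of_forall fun t => (hgρ t).restrict.aestronglyMeasurable)
          (hint s ⟨by linarith [hs.1], by linarith [hs.2]⟩).integrableOn ?_ ?_
          (integrable_const (n : ℝ)) hderivs).2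
        · refine aestronglyMeasurable_of_tendsto_ae atTop
            (f := fun (m : ℕ) ω => ((m : ℝ) + 1) * (g (s + 1 / ((m : ℝ) + 1)) ω - g s ω))
            (fun m => (((hgρ _).sub (hgρ _)).const_mul _).restrict.aestronglyMeasurable) ?_
          filter_upwards [hderivs] with ω hω
          have h₁ := (hasDerivAt_iff_tendsto_slope_zero.1 hω).comp
            (tendsto_nhdsWithin_of_tendsto_nhds_of_eventually_within _
              tendsto_one_div_add_atTop_nhds_zero_nat
              (.of_forall fun m => (Nat.one_div_pos_of_nat (α := ℝ)).ne'))
          refine h₁.congr fun m => ?_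
          simp [smul_eq_mul]
        · filter_upwards [ae_restrict_of_ae hlipρ] with ω hω
          simpa using hω.mono Ioo_subset_Icc_self
      have hb : ∀ s, ‖∫ ω in E, deriv (fun s => g s ω) s ∂ρ‖ ≤ ∫ ω in E, k ω ∂ρ := fun s =>
        norm_integral_le_of_norm_le hkρ.integrableOn
          (ae_restrict_of_ae (ae_restrict_of_ae ((hderiv s).mono fun ω h => h.2)))
      have := norm_image_sub_le_of_norm_deriv_le_segment' (a := (0 : ℝ)) (b := 1)
        (fun s hs => (hd s hs).hasDerivWithinAt) (fun s _ => hb s) 1 ⟨zero_le_one, le_rfl⟩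
      rw [integral_sub (hint 1 (by norm_num)).integrableOn (hint 0 (by norm_num)).integrableOn]
      simpa using this
    have hI := (hint 1 (by norm_num)).sub (hint 0 (by norm_num))
    have h₁ := ae_le_of_forall_setIntegral_le hI hkρ
      fun E _ _ => (le_abs_self _).trans (hset E)
    have h₂ := ae_le_of_forall_setIntegral_le hI.neg hkρ
      fun E _ _ => by
        simp only [Pi.neg_apply, integral_neg]
        exact (neg_le_abs _).trans (hset E)
    filter_upwards [h₁, h₂] with ω e₁ e₂
    simp only [Pi.neg_apply, Pi.sub_apply] at e₁ e₂
    rw [abs_le]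
    constructor <;> linarith
  have hall := ae_all_iff.2 fun n => (ae_restrict_iff'₀ (hAm n)).1 (key n)
  filter_upwards [hall, hAcover] with ω h ⟨n, hn⟩ using h n hn

variable {L : ℕ}

namespace DensityHyp

variable {ψ : EuclideanSpace ℝ (Fin L) → ℝ → ℝ → ℝ} {μ : ℝ → ℝ} {K : ℝ → ℝ → ℝ}

theorem volume_restrict_eq_prod : (volume : Measure (ℝ × ℝ)).restrict (Ioi 0 ×ˢ univ) =
    (volume.restrict (Ioi 0)).prod volume := by
  rw [Measure.volume_eq_prod, ← Measure.prod_restrict, Measure.restrict_univ]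

/-- Joint measurability controls only almost every section. These parameters are dense, and
continuity in `u` carries measurability to every section. -/
theorem aemeasurable_section (h : DensityHyp ψ μ K) (u : EuclideanSpace ℝ (Fin L)) :
    AEMeasurable (fun p : ℝ × ℝ => ψ u p.1 p.2) (volume.restrict (Ioi 0 ×ˢ univ)) := by
  have h₁ : AEStronglyMeasurable (fun p : EuclideanSpace ℝ (Fin L) × ℝ × ℝ => ψ p.1 p.2.1 p.2.2)
      (volume.prod (volume.restrict (Ioi 0 ×ˢ univ))) := by
    have := h.meas.aestronglyMeasurable
    rwa [Measure.volume_eq_prod, ← Measure.prod_restrict, Measure.restrict_univ] at this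
  have hd : Dense {u | AEStronglyMeasurable (fun p : ℝ × ℝ => ψ u p.1 p.2)
      (volume.restrict (Ioi 0 ×ˢ univ))} := Measure.dense_of_ae h₁.prodMk_left
  obtain ⟨v, hv, hlim⟩ := mem_closure_iff_seq_limit.1 (hd u)
  refine aemeasurable_of_tendsto_metrizable_ae atTop (fun n => (hv n).aemeasurable) ?_
  filter_upwards [h.loc_lip] with p hp
  exact (hp.continuous.tendsto u).comp hlim

theorem ae_abs_sub_le (h : DensityHyp ψ μ K) (u u' : EuclideanSpace ℝ (Fin L)) :
    ∀ᵐ p : ℝ × ℝ ∂volume.restrict (Ioi 0 ×ˢ univ),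
      |ψ u p.1 p.2 - ψ u' p.1 p.2| ≤ K p.1 p.2 * ‖u - u'‖ := by
  have hγ : ∀ s : ℝ, HasDerivAt (fun s : ℝ => u' + s • (u - u')) (u - u') s := fun s => by
    simpa using ((hasDerivAt_id s).smul_const (u - u')).const_add u'
  have := ae_abs_sub_le_of_abs_deriv_le (ν := volume.restrict (Ioi 0 ×ˢ univ))
    (g := fun s (p : ℝ × ℝ) => ψ (u' + s • (u - u')) p.1 p.2)
    (k := fun p : ℝ × ℝ => K p.1 p.2 * ‖u - u'‖)
    (fun s => h.aemeasurable_section _) (h.K_int.mul_const _) ?_ fun s => ?_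
  · simpa using this
  · filter_upwards [h.loc_lip] with p hp
    have h₁ : LocallyLipschitz fun s : ℝ => u' + s • (u - u') := by
      have : ContDiff ℝ 1 fun s : ℝ => u' + s • (u - u') := by fun_prop
      exact this.locallyLipschitz
    exact (hp.comp h₁).locallyLipschitzOn.exists_lipschitzOnWith_of_compact isCompact_Icc
  · filter_upwards [h.grad_bound (u' + s • (u - u'))] with p ⟨hd, hK⟩
    have h₁ := hd.hasFDerivAt.comp_hasDerivAt s (hγ s)
    refine ⟨h₁.differentiableAt, ?_⟩
    change |deriv ((fun u => ψ u p.1 p.2) ∘ fun s : ℝ => u' + s • (u - u')) s| ≤ _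
    rw [h₁.deriv]
    rw [gradient, LinearIsometryEquiv.norm_map] at hK
    exact (ContinuousLinearMap.le_opNorm _ _).trans
      (mul_le_mul_of_nonneg_right hK (norm_nonneg _))

/-- The properties of `ψ u r` that hold for almost every `r`. -/
theorem ae_section (h : DensityHyp ψ μ K) (u : EuclideanSpace ℝ (Fin L)) :
    ∀ᵐ r ∂volume.restrict (Ioi (0 : ℝ)), AEStronglyMeasurable (ψ u r) volume ∧
      ∀ᵐ v, 0 ≤ ψ u r v ∧ ψ u r v ≤ μ r := by
  have h₁ := (h.aemeasurable_section u).aestronglyMeasurable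
  have h₂ := h.bound u
  rw [volume_restrict_eq_prod] at h₁ h₂
  filter_upwards [h₁.prodMk_left, Measure.ae_ae_of_ae_prod h₂] with r h₃ h₄ using ⟨h₃, h₄⟩

theorem ae_nonneg (h : DensityHyp ψ μ K) : ∀ᵐ r ∂volume.restrict (Ioi (0 : ℝ)), 0 ≤ μ r := by
  filter_upwards [h.ae_section 0] with r hr
  obtain ⟨v, hv⟩ := hr.2.exists
  exact hv.1.trans hv.2

theorem ae_intervalIntegrable (h : DensityHyp ψ μ K) (u : EuclideanSpace ℝ (Fin L)) :
    ∀ᵐ r ∂volume.restrict (Ioi (0 : ℝ)), ∀ x y, IntervalIntegrable (ψ u r) volume x y := by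
  filter_upwards [h.ae_section u] with r hr x y
  refine (intervalIntegrable_const (c := μ r)).mono_fun hr.1.restrict ?_
  filter_upwards [ae_restrict_of_ae hr.2] with v hv
  rw [Real.norm_of_nonneg hv.1, Real.norm_of_nonneg (hv.1.trans hv.2)]
  exact hv.2

/-- The inner integral in the Preisach operator is monotone and Lipschitz in its upper limit. -/
theorem ae_integral_sub (h : DensityHyp ψ μ K) (u : EuclideanSpace ℝ (Fin L)) :
    ∀ᵐ r ∂volume.restrict (Ioi (0 : ℝ)), ∀ x y, x ≤ y →
      0 ≤ (∫ v in 0..y, ψ u r v) - (∫ v in 0..x, ψ u r v) ∧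
        (∫ v in 0..y, ψ u r v) - (∫ v in 0..x, ψ u r v) ≤ μ r * (y - x) := by
  filter_upwards [h.ae_section u, h.ae_intervalIntegrable u] with r hr hi x y hxy
  rw [intervalIntegral.integral_interval_sub_left (hi 0 y) (hi 0 x)]
  refine ⟨intervalIntegral.integral_nonneg_of_ae hxy (hr.2.mono fun v hv => hv.1), ?_⟩
  have := intervalIntegral.integral_mono_ae hxy (hi x y) (intervalIntegrable_const (c := μ r))
    (hr.2.mono fun v hv => hv.2)
  simpa [mul_comm] using this

/-- Bounding by the integral of `K r` over the whole line makes the estimate uniform in the upper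
limit, hence independent of the play. -/
theorem ae_abs_integral_sub_le (h : DensityHyp ψ μ K) (u u' : EuclideanSpace ℝ (Fin L)) :
    ∀ᵐ r ∂volume.restrict (Ioi (0 : ℝ)), ∀ x,
      |(∫ v in 0..x, ψ u r v) - (∫ v in 0..x, ψ u' r v)| ≤ (∫ v, K r v) * ‖u - u'‖ := by
  have h₁ := h.ae_abs_sub_le u u'
  have h₂ := h.K_int
  rw [IntegrableOn] at h₂
  rw [volume_restrict_eq_prod] at h₁ h₂
  filter_upwards [Measure.ae_ae_of_ae_prod h₁, h₂.prod_right_ae, h.ae_intervalIntegrable u,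
    h.ae_intervalIntegrable u'] with r hr hK hi hi' x
  rw [← intervalIntegral.integral_sub (hi 0 x) (hi' 0 x), ← integral_mul_const, ← Real.norm_eq_abs]
  refine (intervalIntegral.norm_integral_le_integral_norm_uIoc).trans ?_
  have hK' : Integrable (fun v => K r v * ‖u - u'‖) := hK.mul_const _
  refine (setIntegral_mono_on_ae ?_ hK'.integrableOn measurableSet_uIoc
    (hr.mono fun v hv _ => hv)).trans (setIntegral_le_integral hK' ?_)
  · exact ((hi 0 x).sub (hi' 0 x)).norm.def'
  · exact hr.mono fun v hv => (abs_nonneg _).trans hv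

end DensityHyp

/-- Measurable bounded memory curves. -/
structure IsMemory (p : ℝ → ℝ) : Prop where
  aemeasurable : AEMeasurable p (volume.restrict (Ioi 0))
  bounded : ∃ B, ∀ r > 0, |p r| ≤ B

/-- The Preisach functional on memory curves. -/
noncomputable def memoryIntegral (ψ : EuclideanSpace ℝ (Fin L) → ℝ → ℝ → ℝ)
    (u : EuclideanSpace ℝ (Fin L)) (p : ℝ → ℝ) : ℝ :=
  ∫ r in Ioi 0, ∫ v in 0..p r, ψ u r v

namespace DensityHyp

variable {ψ : EuclideanSpace ℝ (Fin L) → ℝ → ℝ → ℝ} {μ : ℝ → ℝ} {K : ℝ → ℝ → ℝ}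

theorem aestronglyMeasurable_memory (h : DensityHyp ψ μ K) (u : EuclideanSpace ℝ (Fin L))
    {p : ℝ → ℝ} (hp : AEMeasurable p (volume.restrict (Ioi 0))) :
    AEStronglyMeasurable (fun r => ∫ v in 0..p r, ψ u r v) (volume.restrict (Ioi 0)) := by
  suffices H : ∀ p : ℝ → ℝ, Measurable p →
      AEStronglyMeasurable (fun r => ∫ v in 0..p r, ψ u r v) (volume.restrict (Ioi 0)) by
    refine (H _ hp.measurable_mk).congr ?_
    filter_upwards [hp.ae_eq_mk] with r hr
    rw [hr]
  intro p hp
  have h₁ := (h.aemeasurable_section u).aestronglyMeasurable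
  rw [volume_restrict_eq_prod] at h₁
  have hA : MeasurableSet {x : ℝ × ℝ | x.2 ∈ Ioc 0 (p x.1)} :=
    (measurableSet_lt measurable_const measurable_snd).inter
      (measurableSet_le measurable_snd (hp.comp measurable_fst))
  have hB : MeasurableSet {x : ℝ × ℝ | x.2 ∈ Ioc (p x.1) 0} :=
    (measurableSet_lt (hp.comp measurable_fst) measurable_snd).inter
      (measurableSet_le measurable_snd measurable_const)
  refine ((h₁.indicator hA).integral_prod_right'.sub (h₁.indicator hB).integral_prod_right').congr
    (.of_forall fun r => ?_)
  simp only [intervalIntegral, Pi.sub_apply]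
  rw [← integral_indicator measurableSet_Ioc, ← integral_indicator measurableSet_Ioc]
  rfl

theorem integrableOn_memory (h : DensityHyp ψ μ K) (u : EuclideanSpace ℝ (Fin L))
    {p : ℝ → ℝ} (hp : IsMemory p) :
    IntegrableOn (fun r => ∫ v in 0..p r, ψ u r v) (Ioi 0) := by
  obtain ⟨B, hB⟩ := hp.bounded
  refine (h.μ_int.mul_const B).mono' (h.aestronglyMeasurable_memory u hp.aemeasurable) ?_
  filter_upwards [h.ae_integral_sub u, h.ae_nonneg, self_mem_ae_restrict measurableSet_Ioi]
    with r hr hμ hr0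
  have hB' := hB r hr0
  have h₁ : |∫ v in 0..p r, ψ u r v| ≤ μ r * |p r| := by
    rcases le_total 0 (p r) with h0 | h0
    · have := hr 0 (p r) h0
      simp only [intervalIntegral.integral_same, sub_zero] at this
      rw [abs_of_nonneg this.1, abs_of_nonneg h0]
      exact this.2
    · have := hr (p r) 0 h0
      simp only [intervalIntegral.integral_same, zero_sub] at this
      rw [abs_of_nonpos (by linarith), abs_of_nonpos h0]
      exact this.2
  exact h₁.trans (mul_le_mul_of_nonneg_left hB' hμ)

theorem memoryIntegral_sub (h : DensityHyp ψ μ K) (u : EuclideanSpace ℝ (Fin L))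
    {p p' : ℝ → ℝ} (hp : IsMemory p) (hp' : IsMemory p') :
    ∃ k, IntegrableOn k (Ioi 0) ∧ memoryIntegral ψ u p - memoryIntegral ψ u p' = ∫ r in Ioi 0, k r ∧
      ∀ᵐ r ∂volume.restrict (Ioi (0 : ℝ)), |k r| ≤ μ r * |p r - p' r| ∧
        (p' r ≤ p r → 0 ≤ k r) ∧ (p r ≤ p' r → k r ≤ 0) := by
  refine ⟨_, (h.integrableOn_memory u hp).sub (h.integrableOn_memory u hp'),
    (integral_sub (h.integrableOn_memory u hp) (h.integrableOn_memory u hp')).symm, ?_⟩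
  filter_upwards [h.ae_integral_sub u] with r hr
  simp only [Pi.sub_apply]
  refine ⟨?_, fun hle => (hr _ _ hle).1, fun hle => by linarith [(hr _ _ hle).1]⟩
  rcases le_total (p' r) (p r) with hle | hle
  · rw [abs_of_nonneg (hr _ _ hle).1, abs_of_nonneg (sub_nonneg.2 hle)]
    exact (hr _ _ hle).2
  · rw [abs_sub_comm, abs_of_nonneg (hr _ _ hle).1, abs_sub_comm, abs_of_nonneg (sub_nonneg.2 hle)]
    exact (hr _ _ hle).2

theorem abs_memoryIntegral_sub_le (h : DensityHyp ψ μ K) (u : EuclideanSpace ℝ (Fin L))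
    {p p' : ℝ → ℝ} (hp : IsMemory p) (hp' : IsMemory p') {d : ℝ} (hd : ∀ r > 0, |p r - p' r| ≤ d) :
    |memoryIntegral ψ u p - memoryIntegral ψ u p'| ≤ (∫ r in Ioi 0, μ r) * d := by
  obtain ⟨k, hk, heq, hb⟩ := h.memoryIntegral_sub u hp hp'
  rw [heq, ← integral_mul_const, ← Real.norm_eq_abs]
  refine norm_integral_le_of_norm_le (h.μ_int.mul_const d) ?_
  filter_upwards [hb, h.ae_nonneg, self_mem_ae_restrict measurableSet_Ioi] with r h₁ h₂ h₃
  exact h₁.1.trans (mul_le_mul_of_nonneg_left (hd r h₃) h₂)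

theorem memoryIntegral_mono (h : DensityHyp ψ μ K) (u : EuclideanSpace ℝ (Fin L))
    {p p' : ℝ → ℝ} (hp : IsMemory p) (hp' : IsMemory p') (hd : ∀ r > 0, p r ≤ p' r) :
    memoryIntegral ψ u p ≤ memoryIntegral ψ u p' := by
  obtain ⟨k, hk, heq, hb⟩ := h.memoryIntegral_sub u hp hp'
  have : ∫ r in Ioi 0, k r ≤ 0 := by
    refine integral_nonpos_of_ae ?_
    filter_upwards [hb, self_mem_ae_restrict measurableSet_Ioi] with r h₁ h₃
    exact h₁.2.2 (hd r h₃)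
  linarith

theorem abs_memoryIntegral_sub_param_le (h : DensityHyp ψ μ K) (u u' : EuclideanSpace ℝ (Fin L))
    {p : ℝ → ℝ} (hp : IsMemory p) :
    |memoryIntegral ψ u p - memoryIntegral ψ u' p| ≤ (∫ r in Ioi 0, ∫ v, K r v) * ‖u - u'‖ := by
  rw [memoryIntegral, memoryIntegral,
    ← integral_sub (h.integrableOn_memory u hp) (h.integrableOn_memory u' hp),
    ← integral_mul_const, ← Real.norm_eq_abs]
  have hK := h.K_int
  rw [IntegrableOn, volume_restrict_eq_prod] at hK
  refine norm_integral_le_of_norm_le (hK.integral_prod_left.mul_const _) ?_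
  filter_upwards [h.ae_abs_integral_sub_le u u'] with r hr using hr _

theorem integral_nonneg (h : DensityHyp ψ μ K) : 0 ≤ ∫ r in Ioi 0, μ r :=
  integral_nonneg_of_ae h.ae_nonneg

theorem integral_integral_nonneg (h : DensityHyp ψ μ K) : 0 ≤ ∫ r in Ioi 0, ∫ v, K r v := by
  have h₁ := h.grad_bound 0
  rw [volume_restrict_eq_prod] at h₁
  refine integral_nonneg_of_ae ?_
  filter_upwards [Measure.ae_ae_of_ae_prod h₁] with r hr
  exact integral_nonneg_of_ae (hr.mono fun v hv => (norm_nonneg _).trans hv.2)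

end DensityHyp

/-! ### The exponential weight -/

theorem _root_.AbsolutelyContinuousOnInterval.exp_comp {f : ℝ → ℝ} {a b : ℝ}
    (hf : AbsolutelyContinuousOnInterval f a b) :
    AbsolutelyContinuousOnInterval (fun x => Real.exp (f x)) a b := by
  obtain ⟨C, hC⟩ := hf.exists_bound
  obtain ⟨k, hk⟩ := (Real.contDiff_exp (n := 1)).locallyLipschitz.locallyLipschitzOn
    |>.exists_lipschitzOnWith_of_compact (isCompact_Icc (a := -C) (b := C))
  have hmem : ∀ x ∈ uIcc a b, f x ∈ Icc (-C) C := fun x hx => abs_le.1 (hC x hx)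
  rw [absolutelyContinuousOnInterval_iff] at hf ⊢
  intro ε hε
  obtain ⟨δ, hδ, H⟩ := hf (ε / (k + 1)) (by positivity)
  refine ⟨δ, hδ, fun E hE hE' => ?_⟩
  have h₁ := H E hE hE'
  rw [lt_div_iff₀ (by positivity)] at h₁
  refine lt_of_le_of_lt ?_ h₁
  rw [Finset.sum_mul]
  refine Finset.sum_le_sum fun i hi => ?_
  have h₂ := hk.dist_le_mul _ (hmem _ (hE.1 i hi).1) _ (hmem _ (hE.1 i hi).2)
  nlinarith [dist_nonneg (x := f (E.2 i).1) (y := f (E.2 i).2)]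

/-- With `m s = ∫_s^∞ μ`, the integrand is almost everywhere `-(exp ∘ m)'`. As `μ` is only
integrable, the fundamental theorem is used for the absolutely continuous function `exp ∘ m`. -/
theorem integral_mul_exp_integral_Ioi_le {μ : ℝ → ℝ} (hμ : Integrable μ) (h0 : 0 ≤ᵐ[volume] μ) :
    Integrable (fun s => μ s * Real.exp (∫ x in Ioi s, μ x)) ∧
      ∀ r, ∫ s in Ioi r, μ s * Real.exp (∫ x in Ioi s, μ x) ≤
        Real.exp (∫ x in Ioi r, μ x) - 1 := by
  have hanti : Antitone fun s => ∫ x in Ioi s, μ x := fun s t hst =>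
    setIntegral_mono_set hμ.integrableOn (ae_restrict_of_ae h0) (Ioi_subset_Ioi hst).eventuallyLE
  have hint : Integrable fun s => μ s * Real.exp (∫ x in Ioi s, μ x) := by
    refine (hμ.mul_const (Real.exp (∫ x, μ x))).mono
      (hμ.1.mul (Real.measurable_exp.comp hanti.measurable).aestronglyMeasurable)
      (.of_forall fun s => ?_)
    rw [norm_mul, norm_mul, Real.norm_of_nonneg (Real.exp_pos _).le,
      Real.norm_of_nonneg (Real.exp_pos _).le]
    exact mul_le_mul_of_nonneg_left (Real.exp_le_exp.2 (setIntegral_le_integral hμ h0))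
      (norm_nonneg _)
  refine ⟨hint, fun r => le_of_tendsto
    (intervalIntegral_tendsto_integral_Ioi r hint.integrableOn tendsto_id) ?_⟩
  filter_upwards [eventually_ge_atTop r] with b hb
  have hm : ∀ s, ∫ x in Ioi s, μ x = (∫ x in Ioi r, μ x) - ∫ x in r..s, μ x := fun s => by
    rw [← intervalIntegral.integral_interval_add_Ioi (hμ.integrableOn (s := Ioi r))
      (hμ.integrableOn (s := Ioi s))]
    ring
  have hac : AbsolutelyContinuousOnInterval (fun s => ∫ x in Ioi s, μ x) r b := by
    rw [funext hm]
    have h₁ : AbsolutelyContinuousOnInterval (fun _ : ℝ => ∫ x in Ioi r, μ x) r b :=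
      ((LipschitzWith.const _).lipschitzOnWith (K := 0)).absolutelyContinuousOnInterval
    exact h₁.fun_sub
      (hμ.intervalIntegrable.absolutelyContinuousOnInterval_intervalIntegral (by simp))
  have h₁ := hac.exp_comp.integral_deriv_eq_sub
  have h₂ : ∫ s in r..b, μ s * Real.exp (∫ x in Ioi s, μ x) =
      -∫ s in r..b, deriv (fun s => Real.exp (∫ x in Ioi s, μ x)) s := by
    rw [← intervalIntegral.integral_neg]
    refine intervalIntegral.integral_congr_ae ?_
    filter_upwards [(hμ.intervalIntegrable (a := r) (b := b)).ae_hasDerivAt_integral] with s hs hsr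
    have h₃ : HasDerivAt (fun s => ∫ x in Ioi s, μ x) (-μ s) s := by
      rw [funext hm]
      exact (hs (uIoc_subset_uIcc hsr) r left_mem_uIcc).const_sub _
    rw [h₃.exp.deriv]
    ring
  simp only [id]
  rw [h₂, h₁]
  have : 1 ≤ Real.exp (∫ x in Ioi b, μ x) :=
    Real.one_le_exp (integral_nonneg_of_ae (ae_restrict_of_ae h0))
  linarith

/-! ### Discrete inputs -/

/-- The state of the play with threshold `r` after the inputs `x 0, …, x (k - 1)`. -/
def memory (x : ℕ → ℝ) : ℕ → ℝ → ℝ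
  | 0, _ => 0
  | k + 1, r => clip (x k) r (memory x k r)

theorem memory_sub_le (x : ℕ → ℝ) (k : ℕ) (r s : ℝ) : memory x k r - memory x k s ≤ |r - s| := by
  induction k with
  | zero => simp [memory]
  | succ k ih =>
    exact clip_sub_clip_le (by linarith [neg_abs_le (r - s)]) ih (by linarith [le_abs_self (r - s)])

theorem continuous_memory (x : ℕ → ℝ) (k : ℕ) : Continuous (memory x k) := by
  refine (LipschitzWith.of_le_add fun r s => ?_).continuous
  rw [Real.dist_eq]
  linarith [memory_sub_le x k r s]

theorem isMemory_memory (x : ℕ → ℝ) (k : ℕ) : IsMemory (memory x k) := by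
  refine ⟨(continuous_memory x k).aemeasurable, ?_⟩
  induction k with
  | zero => exact ⟨0, fun r _ => by simp [memory]⟩
  | succ k ih =>
    obtain ⟨B, hB⟩ := ih
    refine ⟨max |x k| B, fun r hr => ?_⟩
    have h₁ := abs_le.1 (hB r hr)
    have h₂ := abs_le.1 (le_refl |x k|)
    have h₃ := le_max_left |x k| B
    have h₄ := le_max_right |x k| B
    rw [abs_le]
    constructor
    · rcases le_total (memory x k r) (x k + r) with h | h
      · exact le_trans (by rw [min_eq_left h]; linarith) (le_max_right _ _)
      · exact le_trans (by rw [min_eq_right h]; linarith) (le_max_right _ _)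
    · exact max_le (by linarith) ((min_le_left _ _).trans (by linarith))

theorem isMemory_clip {p : ℝ → ℝ} (hp : IsMemory p) (x : ℝ) : IsMemory fun r => clip x r (p r) := by
  refine ⟨?_, ?_⟩
  · have := hp.aemeasurable
    unfold clip
    fun_prop
  · obtain ⟨B, hB⟩ := hp.bounded
    refine ⟨|x| + B, fun r hr => ?_⟩
    have h₁ := abs_le.1 (hB r hr)
    have h₂ := abs_le.1 (le_refl |x|)
    rw [abs_le]
    constructor
    · rcases le_total (p r) (x + r) with h | h
      · exact le_trans (by rw [min_eq_left h]; linarith) (le_max_right _ _)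
      · exact le_trans (by rw [min_eq_right h]; linarith) (le_max_right _ _)
    · exact max_le (by linarith) ((min_le_left _ _).trans (by linarith))

/-- If the difference of two plays increases at `r`, it is at least as large below `r`. -/
theorem memory_sub_memory_le (x y : ℕ → ℝ) (k : ℕ) {r s : ℝ} (hs : 0 ≤ s) (hsr : s ≤ r)
    (h : memory x k r - memory y k r < memory x (k + 1) r - memory y (k + 1) r) :
    memory x (k + 1) r - memory y (k + 1) r ≤ memory x (k + 1) s - memory y (k + 1) s := by
  have hx := memory_sub_le x (k + 1) r s
  have hy := memory_sub_le y (k + 1) s r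
  rw [abs_of_nonneg (sub_nonneg.2 hsr)] at hx
  rw [abs_sub_comm, abs_of_nonneg (sub_nonneg.2 hsr)] at hy
  -- Either the first play rose and sits on its lower barrier, or the second fell and sits on its
  -- upper barrier. That barrier moves at unit speed in the threshold, while the other memory curve
  -- is 1-Lipschitz.
  rcases lt_or_ge (memory x k r) (memory x (k + 1) r) with h₁ | h₁
  · have h₂ : memory x (k + 1) r = x k - r := clip_eq_sub_of_lt h₁
    have h₃ : x k - s ≤ memory x (k + 1) s := sub_le_clip _ _ _
    linarith
  · have h₂ : memory y (k + 1) r = y k + r :=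
      clip_eq_add_of_lt (hs.trans hsr) (show memory y (k + 1) r < memory y k r by linarith)
    have h₃ : memory y (k + 1) s ≤ y k + s := clip_le_add hs _ _
    linarith

/-- The constant does not depend on `n` because the weighted bound on the memory curves is invariant
under each update, so nothing accumulates over the steps. -/
theorem DensityHyp.abs_sub_le_of_discrete {ψ : EuclideanSpace ℝ (Fin L) → ℝ → ℝ → ℝ} {μ : ℝ → ℝ}
    {K : ℝ → ℝ → ℝ} (h : DensityHyp ψ μ K) {n : ℕ} {u : ℕ → EuclideanSpace ℝ (Fin L)}
    {x y : ℕ → ℝ} {E : ℝ} (hE : 0 < E)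
    (hxy : ∀ k < n, |x k - y k + (memoryIntegral ψ (u k) (memory x (k + 1)) -
      memoryIntegral ψ (u k) (memory y (k + 1)))| ≤ E) :
    ∀ k < n, |x k - y k| ≤ Real.exp (∫ r in Ioi 0, μ r) * E := by
  have hμ₁ : Integrable ((Ioi (0 : ℝ)).indicator μ) := h.μ_int.integrable_indicator measurableSet_Ioi
  have hμ₀ : 0 ≤ᵐ[volume] (Ioi (0 : ℝ)).indicator μ := by
    filter_upwards [(ae_restrict_iff' measurableSet_Ioi).1 h.ae_nonneg] with r hr
    by_cases h0 : r ∈ Ioi (0 : ℝ)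
    · rw [indicator_of_mem h0]; exact hr h0
    · rw [indicator_of_notMem h0]; rfl
  obtain ⟨hint, hle⟩ := integral_mul_exp_integral_Ioi_le hμ₁ hμ₀
  set m : ℝ → ℝ := fun r => ∫ s in Ioi r, (Ioi (0 : ℝ)).indicator μ s with hm
  have hm0 : m 0 = ∫ r in Ioi 0, μ r := setIntegral_congr_fun measurableSet_Ioi
    fun r hr => indicator_of_mem hr μ
  set φ : ℝ → ℝ := fun r => E * Real.exp (m r) with hφ
  have hφ0 : ∀ r, 0 < φ r := fun r => mul_pos hE (Real.exp_pos _)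
  have hφint : ∀ r, 0 ≤ r → IntegrableOn (fun s => μ s * φ s) (Ioi r) ∧
      E + ∫ s in Ioi r, μ s * φ s ≤ φ r := fun r hr => by
    have hcongr : ∀ s ∈ Ioi r, E * ((Ioi (0 : ℝ)).indicator μ s * Real.exp (m s)) = μ s * φ s :=
      fun s hs => by
        rw [indicator_of_mem (show s ∈ Ioi (0 : ℝ) from hr.trans_lt hs)]
        simp only [hφ]; ring
    refine ⟨((hint.const_mul E).integrableOn).congr_fun hcongr measurableSet_Ioi, ?_⟩
    rw [← setIntegral_congr_fun measurableSet_Ioi hcongr, integral_const_mul]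
    have := mul_le_mul_of_nonneg_left (hle r) hE.le
    simp only [hφ]
    linarith
  -- The weighted bound for the difference of the memory curves is propagated.
  have step : ∀ (x y : ℕ → ℝ) (k : ℕ),
      |x k - y k + (memoryIntegral ψ (u k) (memory x (k + 1)) -
        memoryIntegral ψ (u k) (memory y (k + 1)))| ≤ E →
      (∀ r ≥ 0, |memory x k r - memory y k r| ≤ φ r) →
      ∀ r ≥ 0, memory x (k + 1) r - memory y (k + 1) r ≤ φ r := by
    intro x y k hE' ih r hr
    by_contra! hlt
    have hinc : memory x k r - memory y k r < memory x (k + 1) r - memory y (k + 1) r :=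
      (le_abs_self _).trans_lt ((ih r hr).trans_lt hlt)
    have hbelow := fun s (hs : 0 ≤ s) (hsr : s ≤ r) => memory_sub_memory_le x y k hs hsr hinc
    -- A violation at `s` would mean that the difference decreased there, so it would be negative at
    -- every smaller threshold, contrary to its being above `φ r` at `r`.
    have habove : ∀ s, r ≤ s → -φ s ≤ memory x (k + 1) s - memory y (k + 1) s := by
      intro s hs
      by_contra! hlt'
      have h₁ := (abs_le.1 (ih s (hr.trans hs))).1
      have h₂ := memory_sub_memory_le y x k hr hs (by linarith)
      linarith [hφ0 r, hφ0 s]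
    have hzero : x k - y k = memory x (k + 1) 0 - memory y (k + 1) 0 := by
      have hclip : ∀ a b : ℝ, clip a 0 b = a := fun a b => by simp [clip]
      simp only [memory, hclip]
    have hd : memory x (k + 1) r - memory y (k + 1) r ≤ x k - y k := hzero ▸ hbelow 0 le_rfl hr
    obtain ⟨p, hp, heq, hb⟩ := h.memoryIntegral_sub (u k) (isMemory_memory x (k + 1))
      (isMemory_memory y (k + 1))
    -- Up to `r` the curves are ordered, so `p ≥ 0`; beyond `r` either `p ≥ 0` or `habove` gives `p
    -- ≥ -μ φ`.
    have hIint : -∫ s in Ioi r, μ s * φ s ≤ ∫ s in Ioi 0, p s := by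
      have hpind : Integrable ((Ioi (0 : ℝ)).indicator p) := hp.integrable_indicator measurableSet_Ioi
      rw [← integral_neg, ← integral_indicator measurableSet_Ioi,
        ← integral_indicator measurableSet_Ioi]
      refine integral_mono_ae ((hφint r hr).1.neg.integrable_indicator measurableSet_Ioi) hpind ?_
      filter_upwards [(ae_restrict_iff' measurableSet_Ioi).1 hb,
        (ae_restrict_iff' measurableSet_Ioi).1 h.ae_nonneg] with s h₁ h₂
      by_cases hs0 : 0 < s
      · obtain ⟨h₃, h₄, h₅⟩ := h₁ hs0
        have h₂ := h₂ hs0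
        rw [indicator_of_mem (show s ∈ Ioi (0 : ℝ) from hs0)]
        by_cases hsr : r < s
        · rw [indicator_of_mem (show s ∈ Ioi r from hsr)]
          rcases le_total (memory y (k + 1) s) (memory x (k + 1) s) with h₆ | h₆
          · have := h₄ h₆
            have := mul_nonneg h₂ (hφ0 s).le
            linarith
          · have h₇ := habove s hsr.le
            rw [abs_of_nonpos (sub_nonpos.2 h₆)] at h₃
            have := mul_le_mul_of_nonneg_left (show -(memory x (k + 1) s - memory y (k + 1) s) ≤ φ s
              by linarith) h₂
            linarith [neg_abs_le (p s)]
        · rw [indicator_of_notMem (show s ∉ Ioi r from hsr)]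
          have := hbelow s hs0.le (not_lt.1 hsr)
          exact h₄ (by linarith [hφ0 r])
      · rw [indicator_of_notMem (show s ∉ Ioi (0 : ℝ) from hs0),
          indicator_of_notMem (show s ∉ Ioi r from fun hs => hs0 (hr.trans_lt hs))]
    have := (abs_le.1 hE').2
    have := (hφint r hr).2
    linarith
  have key : ∀ k ≤ n, ∀ r ≥ 0, |memory x k r - memory y k r| ≤ φ r := by
    intro k
    induction k with
    | zero => intro _ r _; simpa [memory] using (hφ0 r).le
    | succ k ih =>
      intro hk r hr
      have ih := ih (by omega)
      have h₁ := step x y k (hxy k hk) ih r hr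
      have h₂ := step y x k (by
        rw [← abs_neg]; convert hxy k hk using 2; ring)
        (fun r hr => by rw [abs_sub_comm]; exact ih r hr) r hr
      rw [abs_le]
      constructor <;> linarith
  intro k hk
  have := key (k + 1) hk 0 le_rfl
  have hclip : ∀ a b : ℝ, clip a 0 b = a := fun a b => by simp [clip]
  simp only [memory, hclip, hφ, hm0] at this
  linarith

/-! ### Memory curves of regulated inputs -/

theorem abs_explicitPlay_le {r t B : ℝ} {q : ℝ → ℝ} (hr : 0 ≤ r) (ht : 0 ≤ t)
    (hB : ∀ s ∈ Icc 0 t, |q s| ≤ B) : |explicitPlay r q t| ≤ B := by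
  have h0 : 0 ≤ B := (abs_nonneg _).trans (hB t ⟨ht, le_rfl⟩)
  rw [abs_le]
  refine ⟨le_playFrom ht (.inl ⟨by linarith, fun τ hτ => ?_⟩), playFrom_le hr ht fun v hv => ?_⟩
  · linarith [(abs_le.1 (hB τ hτ)).1]
  · rcases hv with ⟨h, _⟩ | ⟨σ, hσ, h, _⟩
    · linarith
    · linarith [(abs_le.1 (hB σ hσ)).2]

theorem explicitPlay_sub_le {r s t : ℝ} {q : ℝ → ℝ} (hr : 0 ≤ r) (ht : 0 ≤ t) :
    explicitPlay r q t - explicitPlay s q t ≤ |r - s| := by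
  rw [sub_le_iff_le_add']
  refine playFrom_le hr ht fun v hv => ?_
  have h₁ := le_abs_self (r - s)
  have h₂ := neg_abs_le (r - s)
  suffices v - |r - s| ∈ playLevels s q 0 0 t by
    have h₃ : v - |r - s| ≤ explicitPlay s q t := le_playFrom ht this
    linarith
  rcases hv with ⟨h, h'⟩ | ⟨σ, hσ, h, h'⟩
  · exact .inl ⟨by linarith, fun τ hτ => by linarith [h' τ hτ]⟩
  · exact .inr ⟨σ, hσ, by linarith, fun τ hτ => by linarith [h' τ hτ]⟩

theorem isMemory_explicitPlay {T t : ℝ} {q : ℝ → ℝ} (hq : RightRegulated T q) (ht : t ∈ Icc 0 T) :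
    IsMemory fun r => explicitPlay r q t := by
  refine ⟨ContinuousOn.aemeasurable ?_ measurableSet_Ioi, ?_⟩
  · refine (LipschitzOnWith.of_dist_le_mul (K := 1) fun r hr s hs => ?_).continuousOn
    rw [Real.dist_eq, Real.dist_eq, NNReal.coe_one, one_mul, abs_le]
    have h₁ := explicitPlay_sub_le (q := q) (r := r) (s := s) (le_of_lt hr) ht.1
    have h₂ := explicitPlay_sub_le (q := q) (r := s) (s := r) (le_of_lt hs) ht.1
    rw [abs_sub_comm] at h₂
    constructor <;> linarith
  · obtain ⟨B, -, hB⟩ := hq.exists_bound (ht.1.trans ht.2)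
    exact ⟨B, fun r hr => abs_explicitPlay_le hr.le ht.1 fun s hs => hB s ⟨hs.1, hs.2.trans ht.2⟩⟩

/-! ### Step functions -/

/-- `t 0 < ⋯ < t n` is a division of `[0,T]`. -/
structure IsDivision (T : ℝ) (n : ℕ) (t : ℕ → ℝ) : Prop where
  left_end : t 0 = 0
  right_end : t n = T
  lt : ∀ i < n, t i < t (i + 1)

/-- The right-continuous step function with value `x i` on `[t i, t (i+1))`. -/
noncomputable def stepFun {F : Type*} (n : ℕ) (t : ℕ → ℝ) (x : ℕ → F) (s : ℝ) : F :=
  x (Nat.findGreatest (fun i => t i ≤ s) n)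

namespace IsDivision

variable {T : ℝ} {n : ℕ} {t : ℕ → ℝ}

theorem strictMono (h : IsDivision T n t) {i j : ℕ} (hij : i < j) (hj : j ≤ n) : t i < t j := by
  induction j, hij using Nat.le_induction with
  | base => exact h.lt i (by omega)
  | succ k _ ih => exact (ih (by omega)).trans (h.lt k (by omega))

theorem mono (h : IsDivision T n t) {i j : ℕ} (hij : i ≤ j) (hj : j ≤ n) : t i ≤ t j := by
  rcases hij.eq_or_lt with rfl | hij
  · exact le_rfl
  · exact (h.strictMono hij hj).le

theorem nonneg (h : IsDivision T n t) {i : ℕ} (hi : i ≤ n) : 0 ≤ t i :=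
  h.left_end ▸ h.mono (Nat.zero_le i) hi

theorem stepFun_eq {F : Type*} (h : IsDivision T n t) (x : ℕ → F) {i : ℕ} {s : ℝ} (hi : i ≤ n)
    (hs : t i ≤ s) (hs' : i < n → s < t (i + 1)) : stepFun n t x s = x i := by
  have : Nat.findGreatest (fun i => t i ≤ s) n = i := by
    refine Nat.findGreatest_eq_iff.2 ⟨hi, fun _ => hs, fun j hij hj => not_le.2 ?_⟩
    exact (hs' (hij.trans_le hj)).trans_le (h.mono hij hj)
  rw [stepFun, this]

theorem exists_cell (h : IsDivision T n t) {s : ℝ} (hs : 0 ≤ s) :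
    ∃ i ≤ n, t i ≤ s ∧ (i < n → s < t (i + 1)) := by
  refine ⟨Nat.findGreatest (fun i => t i ≤ s) n, Nat.findGreatest_le n,
    Nat.findGreatest_spec (P := fun i => t i ≤ s) (Nat.zero_le n) (h.left_end.trans_le hs),
    fun hlt => not_le.1 (Nat.findGreatest_is_greatest (Nat.lt_succ_self _) hlt)⟩

theorem exists_cell_left (h : IsDivision T n t) {s : ℝ} (hs : s ∈ Ioc 0 T) :
    ∃ i < n, t i < s ∧ s ≤ t (i + 1) := by
  have hspec : t (Nat.findGreatest (fun i => t i < s) n) < s :=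
    Nat.findGreatest_spec (P := fun i => t i < s) (Nat.zero_le n) (h.left_end.trans_lt hs.1)
  have hlt : Nat.findGreatest (fun i => t i < s) n < n := by
    refine lt_of_le_of_ne (Nat.findGreatest_le n) fun heq => ?_
    rw [heq, h.right_end] at hspec
    exact not_lt.2 hs.2 hspec
  exact ⟨_, hlt, hspec, not_lt.1 (Nat.findGreatest_is_greatest (Nat.lt_succ_self _) hlt)⟩

theorem rightRegulated_stepFun {F : Type*} [TopologicalSpace F] (h : IsDivision T n t)
    (x : ℕ → F) : RightRegulated T (stepFun n t x) := by
  refine .mk' (fun c hc => ?_) fun c hc => ?_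
  · obtain ⟨i, hi, h₁, h₂⟩ := h.exists_cell_left hc
    refine ⟨x i, tendsto_const_nhds.congr' ?_⟩
    filter_upwards [Ioo_mem_nhdsLT h₁] with s hs
    exact (h.stepFun_eq x hi.le hs.1.le fun _ => hs.2.trans_le h₂).symm
  · obtain ⟨i, hi, h₁, h₂⟩ := h.exists_cell hc.1
    have hin : i < n := lt_of_le_of_ne hi fun heq => by
      rw [heq, h.right_end] at h₁; exact not_lt.2 h₁ hc.2
    rw [h.stepFun_eq x hi h₁ h₂]
    refine tendsto_const_nhds.congr' ?_
    filter_upwards [Ioo_mem_nhdsGT (h₂ hin)] with s hs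
    exact (h.stepFun_eq x hi (h₁.trans hs.1.le) fun _ => hs.2).symm

/-- The index is `k + 1` because the value at time `0` has already projected the initial state `0`
with the input `x 0`. -/
theorem explicitPlay_stepFun_node (h : IsDivision T n t) (x : ℕ → ℝ) {r : ℝ} (hr : 0 ≤ r) {k : ℕ}
    (hk : k ≤ n) : explicitPlay r (stepFun n t x) (t k) = memory x (k + 1) r := by
  have hval : ∀ k ≤ n, stepFun n t x (t k) = x k := fun k hk =>
    h.stepFun_eq x hk le_rfl fun hkn => h.lt k hkn
  induction k with
  | zero =>
    have := hval 0 hk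
    rw [h.left_end] at this ⊢
    rw [explicitPlay_zero hr, this]
    rfl
  | succ k ih =>
    rw [explicitPlay_of_const (d := x k) hr (h.nonneg (by omega)) (h.lt k hk).le fun s hs =>
      h.stepFun_eq x (by omega) hs.1 fun _ => hs.2, ih (by omega), hval _ hk]
    rfl

theorem explicitPlay_stepFun (h : IsDivision T n t) (x : ℕ → ℝ) {r : ℝ} (hr : 0 ≤ r) {k : ℕ}
    (hk : k ≤ n) {s : ℝ} (hs : t k ≤ s) (hs' : k < n → s < t (k + 1)) :
    explicitPlay r (stepFun n t x) s = memory x (k + 1) r := by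
  rw [explicitPlay_of_const (d := x k) hr (h.nonneg hk) hs fun y hy =>
    h.stepFun_eq x hk hy.1 fun hkn => hy.2.trans (hs' hkn), h.explicitPlay_stepFun_node x hr hk,
    h.stepFun_eq x hk hs hs', ← h.explicitPlay_stepFun_node x hr hk]
  refine clip_eq_self ?_
  have := abs_sub_explicitPlay_le (q := stepFun n t x) hr (h.nonneg hk)
  rwa [h.stepFun_eq x hk le_rfl fun hkn => h.lt k hkn] at this

theorem dist_stepFun_le {F : Type*} [PseudoMetricSpace F] (h : IsDivision T n t) {f : ℝ → F} {ε : ℝ}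
    (hε : 0 ≤ ε) (hf : ∀ i < n, ∀ s ∈ Ico (t i) (t (i + 1)), dist (f s) (f (t i)) ≤ ε) :
    ∀ s ∈ Icc 0 T, dist (f s) (stepFun n t (fun i => f (t i)) s) ≤ ε := fun s hs => by
  obtain ⟨i, hi, h₁, h₂⟩ := h.exists_cell hs.1
  rw [h.stepFun_eq _ hi h₁ h₂]
  rcases hi.lt_or_eq with hin | rfl
  · exact hf i hin s ⟨h₁, h₂ hin⟩
  · rw [le_antisymm hs.2 (h.right_end ▸ h₁), h.right_end, dist_self]
    exact hε

theorem abs_explicitPlay_sub_memory_le (h : IsDivision T n t) {q : ℝ → ℝ} {r ε : ℝ} (hr : 0 ≤ r)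
    (hε : 0 ≤ ε) (hq : ∀ i < n, ∀ s ∈ Ico (t i) (t (i + 1)), dist (q s) (q (t i)) ≤ ε) {k : ℕ}
    (hk : k ≤ n) : |explicitPlay r q (t k) - memory (fun i => q (t i)) (k + 1) r| ≤ ε := by
  rw [← h.explicitPlay_stepFun_node _ hr hk]
  exact abs_explicitPlay_sub_le hr (h.nonneg hk) hε fun s hs =>
    h.dist_stepFun_le hε hq s ⟨hs.1, hs.2.trans (h.right_end ▸ h.mono hk le_rfl)⟩

end IsDivision

theorem RightRegulated.prodMk {F G : Type*} [TopologicalSpace F] [TopologicalSpace G] {T : ℝ}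
    {f : ℝ → F} {g : ℝ → G} (hf : RightRegulated T f) (hg : RightRegulated T g) :
    RightRegulated T fun t => (f t, g t) :=
  .mk' (fun t ht => by
    obtain ⟨l, hl⟩ := hf.left_lim t ht
    obtain ⟨m, hm⟩ := hg.left_lim t ht
    exact ⟨_, hl.prodMk_nhds hm⟩)
    fun t ht => (hf.right_cont t ht).prodMk_nhds (hg.right_cont t ht)

/-- A common division for two functions. -/
theorem RightRegulated.exists_isDivision {F G : Type*} [PseudoMetricSpace F] [PseudoMetricSpace G]
    {T t₀ : ℝ} {f : ℝ → F} {g : ℝ → G} (hf : RightRegulated T f) (hg : RightRegulated T g)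
    (ht₀ : t₀ ∈ Icc 0 T) {ε : ℝ} (hε : 0 < ε) : ∃ n t, IsDivision t₀ n t ∧
      (∀ i < n, ∀ s ∈ Ico (t i) (t (i + 1)), dist (f s) (f (t i)) ≤ ε) ∧
      ∀ i < n, ∀ s ∈ Ico (t i) (t (i + 1)), dist (g s) (g (t i)) ≤ ε := by
  obtain ⟨n, t, h0, hn, h⟩ := (hf.prodMk hg).exists_partition ht₀ hε
  exact ⟨n, t, ⟨h0, hn, fun i hi => (h i hi).1⟩,
    fun i hi s hs => (le_max_left _ _).trans ((h i hi).2 s hs),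
    fun i hi s hs => (le_max_right _ _).trans ((h i hi).2 s hs)⟩

/-! ### Stability and existence -/

/-- A solution of the Preisach equation with the explicit play. -/
structure IsExplicitSolution (T : ℝ) (ψ : EuclideanSpace ℝ (Fin L) → ℝ → ℝ → ℝ)
    (u : ℝ → EuclideanSpace ℝ (Fin L)) (w q : ℝ → ℝ) : Prop where
  reg : RightRegulated T q
  eqn : ∀ t ∈ Icc 0 T, q t + memoryIntegral ψ (u t) (fun r => explicitPlay r q t) = w t

namespace DensityHyp

variable {ψ : EuclideanSpace ℝ (Fin L) → ℝ → ℝ → ℝ} {μ : ℝ → ℝ} {K : ℝ → ℝ → ℝ} {T : ℝ}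

theorem abs_sub_le (h : DensityHyp ψ μ K) {u u' : ℝ → EuclideanSpace ℝ (Fin L)}
    {w w' q q' : ℝ → ℝ} (hq : IsExplicitSolution T ψ u w q) (hq' : IsExplicitSolution T ψ u' w' q')
    {t₀ A B : ℝ} (ht₀ : t₀ ∈ Icc 0 T) (hA : ∀ t ∈ Icc 0 t₀, |w t - w' t| ≤ A)
    (hB : ∀ t ∈ Icc 0 t₀, ‖u t - u' t‖ ≤ B) :
    |q t₀ - q' t₀| ≤ Real.exp (∫ r in Ioi 0, μ r) * (A + (∫ r in Ioi 0, ∫ v, K r v) * B) := by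
  set M := ∫ r in Ioi 0, μ r with hM
  set M₁ := ∫ r in Ioi 0, ∫ v, K r v with hM₁
  have hM0 : 0 ≤ M := h.integral_nonneg
  have hM₁0 : 0 ≤ M₁ := h.integral_integral_nonneg
  have hA0 : 0 ≤ A := (abs_nonneg _).trans (hA t₀ ⟨ht₀.1, le_rfl⟩)
  have hB0 : 0 ≤ B := (norm_nonneg _).trans (hB t₀ ⟨ht₀.1, le_rfl⟩)
  have key : ∀ ε > 0, |q t₀ - q' t₀| ≤ Real.exp M * (A + M₁ * B + (2 * M + 1) * ε) := by
    intro ε hε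
    obtain ⟨n, t, hdiv, hqt, hqt'⟩ := hq.reg.exists_isDivision hq'.reg ht₀ hε
    -- Replacing each of the two plays by its discrete memory costs `M * ε`; the additional `ε`
    -- keeps the error positive.
    have hE : 0 < A + M₁ * B + (2 * M + 1) * ε := by positivity
    have := h.abs_sub_le_of_discrete (n := n + 1) (u := fun k => u (t k)) (x := fun k => q (t k))
      (y := fun k => q' (t k)) hE (fun k hk => ?_) n (Nat.lt_succ_self n)
    · simpa only [hdiv.right_end] using this
    have hk : k ≤ n := Nat.lt_succ_iff.1 hk
    have htk : t k ∈ Icc 0 t₀ := ⟨hdiv.nonneg hk, hdiv.right_end ▸ hdiv.mono hk le_rfl⟩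
    have htkT : t k ∈ Icc 0 T := ⟨htk.1, htk.2.trans ht₀.2⟩
    have e₁ := hq.eqn (t k) htkT
    have e₂ := hq'.eqn (t k) htkT
    have e₃ := h.abs_memoryIntegral_sub_le (u (t k)) (isMemory_explicitPlay hq.reg htkT)
      (isMemory_memory (fun k => q (t k)) (k + 1)) (d := ε) fun r hr =>
        hdiv.abs_explicitPlay_sub_memory_le hr.le hε.le hqt hk
    have e₄ := h.abs_memoryIntegral_sub_le (u (t k)) (isMemory_explicitPlay hq'.reg htkT)
      (isMemory_memory (fun k => q' (t k)) (k + 1)) (d := ε) fun r hr =>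
        hdiv.abs_explicitPlay_sub_memory_le hr.le hε.le hqt' hk
    have e₅ := h.abs_memoryIntegral_sub_param_le (u (t k)) (u' (t k))
      (isMemory_explicitPlay hq'.reg htkT)
    have e₆ := hA (t k) htk
    have e₇ := mul_le_mul_of_nonneg_left (hB (t k) htk) hM₁0
    rw [abs_le] at *
    constructor <;> linarith
  refine le_of_forall_pos_le_add fun ε hε => ?_
  have hpos : 0 < Real.exp M * (2 * M + 1) := by positivity
  have := key (ε / (Real.exp M * (2 * M + 1))) (by positivity)
  rw [mul_add, ← mul_assoc (Real.exp M) (2 * M + 1), mul_div_cancel₀ _ hpos.ne'] at this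
  exact this

/-- Since `ψ ≥ 0` and the projection is monotone in the input, the left-hand side is continuous and
grows at least as fast as `x`; the intermediate value theorem applies. -/
theorem exists_clip_solution (h : DensityHyp ψ μ K) (u : EuclideanSpace ℝ (Fin L)) {p : ℝ → ℝ}
    (hp : IsMemory p) (w : ℝ) : ∃ x, x + memoryIntegral ψ u (fun r => clip x r (p r)) = w := by
  set F := fun x : ℝ => x + memoryIntegral ψ u (fun r => clip x r (p r)) with hF
  have hmono : ∀ x y, x ≤ y → y - x ≤ F y - F x := fun x y hxy => by
    have := h.memoryIntegral_mono u (isMemory_clip hp x) (isMemory_clip hp y) fun r _ => by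
      have := clip_sub_clip_le (x := x) (y := y) (r := r) (s := r) (k := p r) (l := p r) (d := 0)
        (by linarith) (by linarith) (by linarith)
      linarith
    simp only [hF]
    linarith
  have hcont : Continuous F := by
    refine continuous_id.add (LipschitzWith.of_dist_le_mul
      (K := ⟨∫ r in Ioi 0, μ r, h.integral_nonneg⟩) fun x y => ?_).continuous
    exact h.abs_memoryIntegral_sub_le u (isMemory_clip hp x) (isMemory_clip hp y) fun r _ =>
      abs_clip_sub_clip_le le_rfl (by simp)
  have hb := abs_nonneg (w - F 0)
  have h₁ := hmono 0 |w - F 0| hb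
  have h₂ := hmono (-|w - F 0|) 0 (by linarith)
  obtain ⟨x, -, hx⟩ := intermediate_value_Icc (show -|w - F 0| ≤ |w - F 0| by linarith)
    hcont.continuousOn (show w ∈ Icc (F (-|w - F 0|)) (F |w - F 0|) from
      ⟨by linarith [neg_abs_le (w - F 0)], by linarith [le_abs_self (w - F 0)]⟩)
  exact ⟨x, hx⟩

theorem exists_discrete_solution (h : DensityHyp ψ μ K) (u : ℕ → EuclideanSpace ℝ (Fin L))
    (w : ℕ → ℝ) : ∃ x : ℕ → ℝ, ∀ k, x k + memoryIntegral ψ (u k) (memory x (k + 1)) = w k := by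
  choose f hf using fun (k : ℕ) (p : {p // IsMemory p}) => h.exists_clip_solution (u k) p.2 (w k)
  -- Each input depends on the memory curve that the earlier inputs produce, so the curves are
  -- constructed first and then identified with `memory`.
  let P : ℕ → {p // IsMemory p} := fun k => Nat.rec
    ⟨fun _ => 0, aemeasurable_const, 0, fun r _ => by simp⟩
    (fun k p => ⟨fun r => clip (f k p) r (p.1 r), isMemory_clip p.2 _⟩) k
  have hP : ∀ k, memory (fun k => f k (P k)) k = (P k).1 := fun k => by
    induction k with
    | zero => rfl
    | succ k ih =>
      funext r
      rw [memory, ih]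
  refine ⟨fun k => f k (P k), fun k => ?_⟩
  rw [hP (k + 1)]
  exact hf k (P k)

theorem exists_step_solution (h : DensityHyp ψ μ K) (hT : 0 ≤ T)
    {u : ℝ → EuclideanSpace ℝ (Fin L)} {w : ℝ → ℝ} (hu : RightRegulated T u)
    (hw : RightRegulated T w) {ε : ℝ} (hε : 0 < ε) : ∃ u' w' q, IsExplicitSolution T ψ u' w' q ∧
      (∀ t ∈ Icc 0 T, ‖u t - u' t‖ ≤ ε) ∧ ∀ t ∈ Icc 0 T, |w t - w' t| ≤ ε := by
  obtain ⟨n, t, hdiv, hut, hwt⟩ := hu.exists_isDivision hw (right_mem_Icc.2 hT) hε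
  obtain ⟨x, hx⟩ := h.exists_discrete_solution (fun k => u (t k)) (fun k => w (t k))
  refine ⟨stepFun n t fun k => u (t k), stepFun n t fun k => w (t k), stepFun n t x,
    ⟨hdiv.rightRegulated_stepFun x, fun s hs => ?_⟩, fun s hs => ?_, hdiv.dist_stepFun_le hε.le hwt⟩
  · obtain ⟨i, hi, h₁, h₂⟩ := hdiv.exists_cell hs.1
    rw [hdiv.stepFun_eq _ hi h₁ h₂, hdiv.stepFun_eq _ hi h₁ h₂, hdiv.stepFun_eq _ hi h₁ h₂, ← hx i]
    congr 1
    refine setIntegral_congr_fun measurableSet_Ioi fun r hr => ?_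
    simp only [hdiv.explicitPlay_stepFun x (le_of_lt hr) hi h₁ h₂]
  · rw [← dist_eq_norm]
    exact hdiv.dist_stepFun_le hε.le hut s hs

/-- Step data within `e n` of `u` and `w` have exact solutions; by the stability estimate these are
uniformly Cauchy, and both sides of the equation are continuous under uniform convergence. -/
theorem exists_explicitSolution (h : DensityHyp ψ μ K) (hT : 0 ≤ T)
    {u : ℝ → EuclideanSpace ℝ (Fin L)} {w : ℝ → ℝ} (hu : RightRegulated T u)
    (hw : RightRegulated T w) : ∃ q, IsExplicitSolution T ψ u w q := by
  set M := ∫ r in Ioi 0, μ r with hM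
  set M₁ := ∫ r in Ioi 0, ∫ v, K r v with hM₁
  have hM0 : 0 ≤ M := h.integral_nonneg
  have hM₁0 : 0 ≤ M₁ := h.integral_integral_nonneg
  set C := Real.exp M * (1 + M₁) with hC
  have hC0 : 0 < C := by positivity
  set e : ℕ → ℝ := fun n => 1 / ((n : ℝ) + 1) with he
  have he0 : ∀ n, 0 < e n := fun n => Nat.one_div_pos_of_nat
  have helim : Tendsto e atTop (𝓝 0) := tendsto_one_div_add_atTop_nhds_zero_nat
  choose us ws qs hsol hus hws using fun n => h.exists_step_solution hT hu hw (he0 n)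
  have hdist : ∀ m n, ∀ t ∈ Icc 0 T, |qs m t - qs n t| ≤ C * (e m + e n) := fun m n t ht => by
    have := h.abs_sub_le (hsol m) (hsol n) (A := e m + e n) (B := e m + e n) ht
      (fun s hs => by
        have h₁ := hws m s ⟨hs.1, hs.2.trans ht.2⟩
        have h₂ := hws n s ⟨hs.1, hs.2.trans ht.2⟩
        rw [abs_le] at *
        constructor <;> linarith)
      (fun s hs => by
        have h₁ := hus m s ⟨hs.1, hs.2.trans ht.2⟩
        have h₂ := hus n s ⟨hs.1, hs.2.trans ht.2⟩
        rw [← dist_eq_norm] at *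
        linarith [dist_triangle_left (us m s) (us n s) (u s)])
    rw [hC]
    linarith
  have hlim : ∀ t, ∃ l, t ∈ Icc 0 T → Tendsto (fun n => qs n t) atTop (𝓝 l) := fun t => by
    by_cases ht : t ∈ Icc 0 T
    · obtain ⟨l, hl⟩ := cauchySeq_tendsto_of_complete (u := fun n => qs n t) (by
        refine Metric.cauchySeq_iff'.2 fun ε hε => ?_
        have h₁ : Tendsto (fun N => C * (e N + e N)) atTop (𝓝 0) := by
          simpa using (helim.add helim).const_mul C
        obtain ⟨N, hN⟩ := (h₁.eventually (gt_mem_nhds hε)).exists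
        refine ⟨N, fun n hn => (hdist n N t ht).trans_lt (lt_of_le_of_lt ?_ hN)⟩
        gcongr
        exact one_div_le_one_div_of_le (by positivity) (by simpa using hn))
      exact ⟨l, fun _ => hl⟩
    · exact ⟨0, fun h => absurd h ht⟩
  choose q hq using hlim
  have hqs : ∀ n, ∀ t ∈ Icc 0 T, |qs n t - q t| ≤ C * e n := fun n t ht => by
    have h₁ : Tendsto (fun m => |qs n t - qs m t|) atTop (𝓝 |qs n t - q t|) :=
      ((hq t ht).const_sub _).abs
    have h₂ : Tendsto (fun m => C * (e n + e m)) atTop (𝓝 (C * (e n + 0))) :=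
      (helim.const_add _).const_mul C
    rw [add_zero] at h₂
    exact le_of_tendsto_of_tendsto' h₁ h₂ fun m => hdist n m t ht
  have hreg : RightRegulated T q := rightRegulated_of_uniform_approx fun ε hε => by
    have h₁ : Tendsto (fun N => C * e N) atTop (𝓝 0) := by simpa using helim.const_mul C
    obtain ⟨n, hn⟩ := (h₁.eventually (gt_mem_nhds hε)).exists
    exact ⟨qs n, (hsol n).reg, fun t ht => (hqs n t ht).trans hn.le⟩
  refine ⟨q, hreg, fun t ht => ?_⟩
  -- The four terms account for replacing `qs n` by `q` outside and inside the Preisach term, `us n`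
  -- by `u`, and `ws n` by `w`.
  have hle : ∀ n, |q t + memoryIntegral ψ (u t) (fun r => explicitPlay r q t) - w t| ≤
      (C + M * C + M₁ + 1) * e n := fun n => by
    have e₀ := (hsol n).eqn t ht
    have e₁ := h.abs_memoryIntegral_sub_le (us n t) (isMemory_explicitPlay (hsol n).reg ht)
      (isMemory_explicitPlay hreg ht) (d := C * e n) fun r hr =>
        abs_explicitPlay_sub_le hr.le ht.1 (mul_pos hC0 (he0 n)).le fun s hs =>
          hqs n s ⟨hs.1, hs.2.trans ht.2⟩
    have e₂ := (h.abs_memoryIntegral_sub_param_le (u t) (us n t) (isMemory_explicitPlay hreg ht)).trans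
      (mul_le_mul_of_nonneg_left (hus n t ht) hM₁0)
    have e₃ := hqs n t ht
    have e₄ := hws n t ht
    rw [abs_le] at *
    constructor <;> linarith
  have h₁ : Tendsto (fun n => (C + M * C + M₁ + 1) * e n) atTop (𝓝 0) := by
    simpa using helim.const_mul (C + M * C + M₁ + 1)
  exact sub_eq_zero.1 (abs_nonpos_iff.1 (ge_of_tendsto' h₁ hle))

end DensityHyp

/-! ### Passage from the explicit play to the play operator, and the theorem -/

theorem preisach_eq_memoryIntegral {ψ : EuclideanSpace ℝ (Fin L) → ℝ → ℝ → ℝ} {T t : ℝ}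
    {u : ℝ → EuclideanSpace ℝ (Fin L)} {q : ℝ → ℝ} (hq : RightRegulated T q) (ht : t ∈ Icc 0 T) :
    preisach T ψ u q t = memoryIntegral ψ (u t) (fun r => explicitPlay r q t) :=
  setIntegral_congr_fun measurableSet_Ioi fun r hr => by
    simp only [play_eq_explicitPlay hr hq ht]

theorem IsSolution.isExplicitSolution {ψ : EuclideanSpace ℝ (Fin L) → ℝ → ℝ → ℝ} {T : ℝ}
    {u : ℝ → EuclideanSpace ℝ (Fin L)} {w q : ℝ → ℝ} (h : IsSolution T ψ u w q) :
    IsExplicitSolution T ψ u w q :=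
  ⟨h.reg, fun t ht => by rw [← preisach_eq_memoryIntegral h.reg ht]; exact h.eqn t ht⟩

theorem IsExplicitSolution.isSolution {ψ : EuclideanSpace ℝ (Fin L) → ℝ → ℝ → ℝ} {μ : ℝ → ℝ}
    {K : ℝ → ℝ → ℝ} {T : ℝ} {u : ℝ → EuclideanSpace ℝ (Fin L)} {w q : ℝ → ℝ}
    (h : IsExplicitSolution T ψ u w q) (hψ : DensityHyp ψ μ K) (hT : 0 ≤ T) :
    IsSolution T ψ u w q where
  reg := h.reg
  play_exists r hr := ⟨_, isPlay_explicitPlay hT hr h.reg⟩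
  inner_int t _ := (hψ.ae_intervalIntegrable (u t)).mono fun r hr => hr 0 _
  outer_int t ht := (hψ.integrableOn_memory (u t) (isMemory_explicitPlay h.reg ht)).congr_fun
    (fun r hr => by simp only [play_eq_explicitPlay hr h.reg ht]) measurableSet_Ioi
  eqn t ht := by rw [preisach_eq_memoryIntegral h.reg ht]; exact h.eqn t ht

theorem RightRegulated.norm_sub_le_supNorm {F : Type*} [SeminormedAddCommGroup F] {T t s : ℝ}
    {f g : ℝ → F} (hf : RightRegulated T f) (hg : RightRegulated T g) (ht : t ∈ Icc 0 T)
    (hs : s ∈ Icc 0 t) : ‖f s - g s‖ ≤ supNorm 0 t fun τ => f τ - g τ := by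
  obtain ⟨A, -, hA⟩ := hf.exists_bound (ht.1.trans ht.2)
  obtain ⟨B, -, hB⟩ := hg.exists_bound (ht.1.trans ht.2)
  refine le_csSup ⟨A + B, ?_⟩ (mem_image_of_mem _ hs)
  rintro _ ⟨τ, hτ, rfl⟩
  have hτ' : τ ∈ Icc 0 T := ⟨hτ.1, hτ.2.trans ht.2⟩
  exact (norm_sub_le _ _).trans (add_le_add (hA τ hτ') (hB τ hτ'))

end Preisach

theorem theorem4p6 {L : ℕ} (T : ℝ) (hT : 0 < T)
    (ψ : EuclideanSpace ℝ (Fin L) → ℝ → ℝ → ℝ) (μ : ℝ → ℝ) (K : ℝ → ℝ → ℝ)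
    (hψ : Preisach.DensityHyp ψ μ K)
    (M : ℝ) (hM : M = ∫ r in Set.Ioi 0, μ r)
    (M₁ : ℝ) (hM₁ : M₁ = ∫ r in Set.Ioi 0, ∫ v, K r v)
    (u u' : ℝ → EuclideanSpace ℝ (Fin L)) (w w' : ℝ → ℝ)
    (hu : Preisach.RightRegulated T u) (hu' : Preisach.RightRegulated T u')
    (hw : Preisach.RightRegulated T w) (hw' : Preisach.RightRegulated T w') :
    (∃ q q' : ℝ → ℝ, Preisach.IsSolution T ψ u w q ∧ Preisach.IsSolution T ψ u' w' q') ∧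
    ∀ q q' : ℝ → ℝ, Preisach.IsSolution T ψ u w q → Preisach.IsSolution T ψ u' w' q' →
      ∀ t ∈ Set.Icc 0 T,
        |q t - q' t| ≤ Real.exp M *
          (Preisach.supNorm 0 t (fun τ => w τ - w' τ) +
            M₁ * Preisach.supNorm 0 t (fun τ => u τ - u' τ)) := by
  subst hM hM₁
  refine ⟨?_, fun q q' hq hq' t ht => ?_⟩
  · obtain ⟨q, hq⟩ := hψ.exists_explicitSolution hT.le hu hw
    obtain ⟨q', hq'⟩ := hψ.exists_explicitSolution hT.le hu' hw'
    exact ⟨q, q', hq.isSolution hψ hT.le, hq'.isSolution hψ hT.le⟩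
  · exact hψ.abs_sub_le hq.isExplicitSolution hq'.isExplicitSolution ht
      (fun s hs => hw.norm_sub_le_supNorm hw' ht hs) fun s hs => hu.norm_sub_le_supNorm hu' ht hs
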